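/- Let $m_0\in\mathbb{R}$, $m_0\neq 0$, let $I\subset(0,\infty)\cap(2m_0,\infty)$ be an interval with nonempty interior (for instance $I=[r_1,r_2]$ with $\max(0,2m_0)<r_1<r_2$), and let $H=\{x\in\mathbb{R}^3 : |x|\in I\}$ with $r=|x|$. On $H$ consider the time-symmetric Schwarzschild data $$\bar g_{m_0}=\Bigl(1-\frac{2m_0}{r}\Bigr)^{-1}dr^2+r^2\,d\sigma_{S^2}^2,\qquad \bar\pi=0 .$$ For a Riemannian metric $\bar g$ and a symmetric $2$-tensor $\bar\pi$ let $$\Phi(\bar g,\bar\pi)=\Bigl(R(\bar g)+\tfrac12(\mathrm{tr}_{\bar g}\bar\pi)^2-|\bar\pi|_{\bar g}^2,\ \mathrm{div}_{\bar g}\bar\pi\Bigr)$$ be the constraint map (with $\mathrm{div}_{\bar g}\bar\pi$ regarded as a vector field), let $D\Phi_{(\bar g,\bar\pi)}(h,\omega)=\frac{d}{dt}\big|_{t=0}\Phi(\bar g+th,\bar\pi+t\omega)$ be its linearization, and let $D\Phi^*_{(\bar g,\bar\pi)}$ be the formal $L^2(\bar g)$-adjoint, defined on pairs $(f,X)$ of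 a smooth function and a smooth vector field on $H$ by $$\int_H \bigl\langle (f,X),D\Phi_{(\bar g,\bar\pi)}(h,\omega)\bigr\rangle_{\bar g}\,d\mu_{\bar g}=\int_H\bigl\langle D\Phi^*_{(\bar g,\bar\pi)}(f,X),(h,\omega)\bigr\rangle_{\bar g}\,d\mu_{\bar g}$$ for all smooth symmetric $2$-tensors $h,\omega$ with compact support in the interior of $H$. Let $$\Omega_1=x^2\partial_3-x^3\partial_2,\qquad \Omega_2=x^3\partial_1-x^1\partial_3,\qquad \Omega_3=x^1\partial_2-x^2\partial_1 .$$ Then the kernel $$K=\mathrm{Ker}\,D\Phi^*_{(\bar g_{m_0},0)}$$ is a real vector space of dimension $4$, and it is spanned by $$\Bigl(\bigl(1-\tfrac{2m_0}{r}\bigr)^{1/2},0\Bigr),\quad (0,\Omega_1),\quad (0,\Omega_2),\quad (0,\Omega_3).$$ -/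

import Mathlib

open scoped ContDiff

noncomputable section

namespace Constraint

/-- Euclidean three-space, with its Cartesian coordinates `x 0, x 1, x 2`. -/
abbrev E3 := EuclideanSpace ℝ (Fin 3)

/-- Components `T_{ij}` of a covariant 2-tensor field in Cartesian coordinates. -/
abbrev Tensor2 := E3 → Matrix (Fin 3) (Fin 3) ℝ

/-- The coordinate partial derivative `∂_i u` at `x`. -/
def pd (i : Fin 3) (u : E3 → ℝ) (x : E3) : ℝ :=
  fderiv ℝ u x (EuclideanSpace.single i 1)

/-- The component `g^{ij}` of the inverse metric. -/
def ginv (g : Tensor2) (x : E3) (i j : Fin 3) : ℝ := (g x)⁻¹ i j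

/-- The Christoffel symbol `Γ^k_{ij}` of `g`. -/
def christoffel (g : Tensor2) (k i j : Fin 3) (x : E3) : ℝ :=
  (1 / 2) * ∑ l, ginv g x k l *
    (pd i (fun y => g y j l) x + pd j (fun y => g y i l) x - pd l (fun y => g y i j) x)

/-- The component `R_{ij}` of the Ricci tensor of `g`. -/
def ricci (g : Tensor2) (x : E3) (i j : Fin 3) : ℝ :=
  ∑ k, (pd k (christoffel g k i j) x - pd j (christoffel g k i k) x
    + ∑ l, (christoffel g k k l x * christoffel g l i j x
      - christoffel g k j l x * christoffel g l i k x))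

/-- The scalar curvature of `g`. -/
def scalarCurv (g : Tensor2) (x : E3) : ℝ := ∑ i, ∑ j, ginv g x i j * ricci g x i j

/-- The trace `g^{ij} p_{ij}`. -/
def traceAt (g p : Tensor2) (x : E3) : ℝ := ∑ i, ∑ j, ginv g x i j * p x i j

/-- The inner product `g^{ik} g^{jl} A_{ij} B_{kl}` of two covariant 2-tensors at `x`. -/
def inner2 (g : Tensor2) (x : E3) (A B : Matrix (Fin 3) (Fin 3) ℝ) : ℝ :=
  ∑ i, ∑ j, ∑ k, ∑ l, ginv g x i k * ginv g x j l * A i j * B k l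

/-- The inner product `g_{ij} V^i W^j` of two tangent vectors at `x`. -/
def inner1 (g : Tensor2) (x : E3) (V W : Fin 3 → ℝ) : ℝ := ∑ i, ∑ j, g x i j * V i * W j

/-- The covariant derivative `∇_j p_{kl}`. -/
def covDeriv (g p : Tensor2) (x : E3) (j k l : Fin 3) : ℝ :=
  pd j (fun y => p y k l) x
    - ∑ s, (christoffel g s j k x * p x s l + christoffel g s j l x * p x k s)

/-- The divergence `(div_g p)^i = g^{il} g^{jk} ∇_j p_{kl}`, as a vector field. -/
def divergence (g p : Tensor2) (x : E3) (i : Fin 3) : ℝ :=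
  ∑ l, ∑ j, ∑ k, ginv g x i l * ginv g x j k * covDeriv g p x j k l

/-- The Hamiltonian constraint `R(g) + (tr p)^2 / 2 - |p|^2`. -/
def hamiltonian (g p : Tensor2) (x : E3) : ℝ :=
  scalarCurv g x + (1 / 2) * traceAt g p x ^ 2 - inner2 g x (p x) (p x)

/-- The constraint map `Φ(g, p) = (H(g, p), div_g p)`. -/
def Phi (g p : Tensor2) (x : E3) : ℝ × (Fin 3 → ℝ) := (hamiltonian g p x, divergence g p x)

/-- The linearization `DΦ_{(g,p)}(h, w) = d/dt Φ(g + t h, p + t w)` at `t = 0`. -/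
def DPhi (g p h w : Tensor2) (x : E3) : ℝ × (Fin 3 → ℝ) :=
  (deriv (fun t : ℝ => (Phi (g + t • h) (p + t • w) x).1) 0,
    fun i => deriv (fun t : ℝ => (Phi (g + t • h) (p + t • w) x).2 i) 0)

/-- The Riemannian volume density `√(det g)`. -/
def volDensity (g : Tensor2) (x : E3) : ℝ := Real.sqrt (g x).det

/-- Smooth symmetric 2-tensor fields with compact support in the interior of `H`. -/
structure IsTest (H : Set E3) (h : Tensor2) : Prop where
  symm : ∀ x i j, h x i j = h x j i
  smooth : ∀ i j, ContDiff ℝ ∞ (fun x => h x i j)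
  compact : HasCompactSupport h
  support : tsupport h ⊆ interior H

/-- `DΦ*_{(g,p)}(f, X) = (a, b)` on `H`, where `DΦ*` is the formal `L²`-adjoint: the two
`L²`-pairings agree against all smooth symmetric `(h, w)` with compact support in the interior. -/
def AdjointEq (H : Set E3) (g p : Tensor2) (f : H → ℝ) (X : H → Fin 3 → ℝ)
    (a b : H → Matrix (Fin 3) (Fin 3) ℝ) : Prop :=
  ∀ h w : Tensor2, IsTest H h → IsTest H w →
    ∫ x : H, (f x * (DPhi g p h w x).1 + inner1 g x (X x) (DPhi g p h w x).2) * volDensity g x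
        ∂(MeasureTheory.Measure.comap Subtype.val MeasureTheory.volume)
      = ∫ x : H, (inner2 g x (a x) (h x) + inner2 g x (b x) (w x)) * volDensity g x
        ∂(MeasureTheory.Measure.comap Subtype.val MeasureTheory.volume)

/-- Smoothness on `H` (up to whatever part of the boundary belongs to `H`). -/
def SmoothOn {F : Type} [NormedAddCommGroup F] [NormedSpace ℝ F] (H : Set E3) (u : H → F) :
    Prop :=
  ContDiffOn ℝ ∞ (Function.extend Subtype.val u 0) H

/-- The null space of `DΦ*_{(g,p)}` on smooth pairs (function, vector field) on `H`. -/
def kerAdjoint (H : Set E3) (g p : Tensor2) : Set ((H → ℝ) × (H → Fin 3 → ℝ)) :=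
  {q | SmoothOn H q.1 ∧ SmoothOn H q.2 ∧ AdjointEq H g p q.1 q.2 0 0}

/-- The spherical shell of points whose radius `r = ‖x‖` lies in `I`. -/
def shell (I : Set ℝ) : Set E3 := {x | ‖x‖ ∈ I}

/-- The metric `(1 - 2m/r)⁻¹ dr² + r² dσ²` in Cartesian coordinates: `dr` has components
`x_i / r`, and `r² dσ²` has components `δ_{ij} - (x_i / r) (x_j / r)`. -/
def schwarzschild (m : ℝ) : Tensor2 := fun x => Matrix.of fun i j =>
  (1 - 2 * m / ‖x‖)⁻¹ * ((x i / ‖x‖) * (x j / ‖x‖))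
    + ((if i = j then 1 else 0) - (x i / ‖x‖) * (x j / ‖x‖))

/-- The lapse `(1 - 2m/r)^{1/2}`. -/
def lapse (m : ℝ) (x : E3) : ℝ := Real.sqrt (1 - 2 * m / ‖x‖)

/-- The rotation field `x² ∂_3 - x³ ∂_2`. -/
def rot1 (x : E3) : Fin 3 → ℝ := ![0, -x 2, x 1]

/-- The rotation field `x³ ∂_1 - x¹ ∂_3`. -/
def rot2 (x : E3) : Fin 3 → ℝ := ![x 2, 0, -x 0]

/-- The rotation field `x¹ ∂_2 - x² ∂_1`. -/
def rot3 (x : E3) : Fin 3 → ℝ := ![-x 1, x 0, 0]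

end Constraint

end

/-!
The constraint equations linearize at `(g, 0)` to the scalar curvature operator in `h` and the
divergence in `ω`. If `R(g) = 0`, two integrations by parts show that `(f, X)` lies in the kernel
of the adjoint iff `∇∇f = f Ric` (`f` is a static potential) and `X` is a Killing field.

*Killing fields.* A Killing field `X` of the Schwarzschild metric preserves the Ricci tensor too.
On vectors orthogonal to `x` the tensors `g` and `Ric` are `δ` and `(m / r³) δ`, so comparing
`L_X g = 0` with `L_X Ric = 0` there shows that `X` preserves `m / r³`: it is tangent to the
spheres `r = const`. It is then a Killing field of the flat metric as well, hence a rotation field.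

*Static potentials.* If `f` and the lapse `N` are static potentials of the same metric, then
`f dN - N df` is dual to a Killing field, hence to a rotation field `c × x`. The exterior derivative
of this form is `2 df ∧ dN`, and `dN` is radial, so the curl `2c` is orthogonal to `x` at every
point of an open set. Thus `c = 0` and `f / N` is constant.
-/

noncomputable section

namespace Constraint

open MeasureTheory Topology

/-! ### Coordinate partial derivatives -/

section Calculus

/-- `u` is differentiable at `x` with coordinate partial derivatives `D`: the analogue of
`HasDerivAt` for `pd`. -/
structure HasGrad (u : E3 → ℝ) (D : Fin 3 → ℝ) (x : E3) : Prop where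
  differentiableAt : DifferentiableAt ℝ u x
  pd_eq : ∀ i, pd i u x = D i

namespace HasGrad

variable {u v : E3 → ℝ} {D D' : Fin 3 → ℝ} {x : E3}

theorem of_differentiableAt (hu : DifferentiableAt ℝ u x) : HasGrad u (fun i => pd i u x) x :=
  ⟨hu, fun _ => rfl⟩

theorem congr_grad (hu : HasGrad u D x) (h : ∀ i, D i = D' i) : HasGrad u D' x :=
  ⟨hu.differentiableAt, fun i => (hu.pd_eq i).trans (h i)⟩

theorem congr_of_eqOn {U : Set E3} (hu : HasGrad u D x) (hU : IsOpen U) (hx : x ∈ U)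
    (h : ∀ y ∈ U, v y = u y) : HasGrad v D x := by
  have hvu : v =ᶠ[𝓝 x] u := Filter.eventually_of_mem (hU.mem_nhds hx) h
  exact ⟨hu.differentiableAt.congr_of_eventuallyEq hvu, fun i => by
    rw [← hu.pd_eq i, pd, pd, hvu.fderiv_eq]⟩

theorem const (c : ℝ) : HasGrad (fun _ => c) (fun _ => 0) x :=
  ⟨differentiableAt_const c, fun i => by simp [pd]⟩

theorem coord (j : Fin 3) :
    HasGrad (fun y : E3 => y j) (fun i => if i = j then 1 else 0) x := by
  have h : HasFDerivAt (fun y : E3 => y j) (EuclideanSpace.proj j : E3 →L[ℝ] ℝ) x :=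
    (EuclideanSpace.proj j : E3 →L[ℝ] ℝ).hasFDerivAt
  refine ⟨h.differentiableAt, fun i => ?_⟩
  rw [pd, h.fderiv]
  simp [eq_comm]

theorem add (hu : HasGrad u D x) (hv : HasGrad v D' x) :
    HasGrad (fun y => u y + v y) (fun i => D i + D' i) x :=
  ⟨hu.differentiableAt.add hv.differentiableAt, fun i => by
    rw [← hu.pd_eq, ← hv.pd_eq, pd, pd, pd,
      fderiv_fun_add hu.differentiableAt hv.differentiableAt]
    rfl⟩

theorem mul (hu : HasGrad u D x) (hv : HasGrad v D' x) :
    HasGrad (fun y => u y * v y) (fun i => D i * v x + u x * D' i) x :=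
  ⟨hu.differentiableAt.mul hv.differentiableAt, fun i => by
    rw [← hu.pd_eq, ← hv.pd_eq, pd, pd, pd,
      fderiv_fun_mul hu.differentiableAt hv.differentiableAt]
    simp only [add_apply, smul_apply, smul_eq_mul]
    ring⟩

theorem const_mul (c : ℝ) (hu : HasGrad u D x) :
    HasGrad (fun y => c * u y) (fun i => c * D i) x :=
  ((const c).mul hu).congr_grad fun i => by ring

theorem sub (hu : HasGrad u D x) (hv : HasGrad v D' x) :
    HasGrad (fun y => u y - v y) (fun i => D i - D' i) x := by
  simpa [sub_eq_add_neg] using hu.add (hv.const_mul (-1))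

theorem sum {ι : Type*} (s : Finset ι) {w : ι → E3 → ℝ} {d : ι → Fin 3 → ℝ}
    (h : ∀ a ∈ s, HasGrad (w a) (d a) x) :
    HasGrad (fun y => ∑ a ∈ s, w a y) (fun i => ∑ a ∈ s, d a i) x :=
  ⟨DifferentiableAt.fun_sum fun a ha => (h a ha).differentiableAt, fun i => by
    rw [pd, fderiv_fun_sum fun a ha => (h a ha).differentiableAt, sum_apply]
    exact Finset.sum_congr rfl fun a ha => (h a ha).pd_eq i⟩

theorem comp_hasDerivAt {F : ℝ → ℝ} {F' : ℝ} (hF : HasDerivAt F F' (u x)) (hu : HasGrad u D x) :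
    HasGrad (fun y => F (u y)) (fun i => F' * D i) x := by
  have h := hF.comp_hasFDerivAt x hu.differentiableAt.hasFDerivAt
  refine ⟨h.differentiableAt, fun i => ?_⟩
  rw [← hu.pd_eq, pd, pd]
  exact congrArg (· (EuclideanSpace.single i 1)) h.fderiv

theorem norm (hx : x ≠ 0) : HasGrad (fun y => ‖y‖) (fun i => x i / ‖x‖) x := by
  have h := (contDiffAt_norm ℝ hx (n := 1)).differentiableAt one_ne_zero
  refine ⟨h, fun i => ?_⟩
  have hsq := (hasStrictFDerivAt_norm_sq x).hasFDerivAt.unique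
    (h.hasFDerivAt.pow 2)
  have hi := congrArg (· (EuclideanSpace.single i (1 : ℝ))) hsq
  have hx' := norm_ne_zero_iff.2 hx
  simp only [smul_apply, innerSL_apply_apply,
    EuclideanSpace.inner_single_right, Real.ringHom_apply, one_mul, nsmul_eq_mul, Nat.cast_ofNat,
    Nat.add_one_sub_one, pow_one, smul_eq_mul] at hi
  rw [pd]
  field_simp
  linarith

end HasGrad

variable {U K : Set E3} {u v : E3 → ℝ} {x : E3}

theorem hasGrad_of_contDiffOn (hU : IsOpen U) (hu : ContDiffOn ℝ ∞ u U) (hx : x ∈ U) :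
    HasGrad u (fun i => pd i u x) x :=
  .of_differentiableAt ((hu.contDiffAt (hU.mem_nhds hx)).differentiableAt (by simp))

theorem contDiffOn_pd (hU : IsOpen U) (hu : ContDiffOn ℝ ∞ u U) (i : Fin 3) :
    ContDiffOn ℝ ∞ (pd i u) U :=
  (hu.fderiv_of_isOpen hU (by simp)).clm_apply contDiffOn_const

theorem pd_congr (hU : IsOpen U) (h : ∀ y ∈ U, u y = v y) (hx : x ∈ U) (i : Fin 3) :
    pd i u x = pd i v x := by
  have huv : u =ᶠ[𝓝 x] v := Filter.eventually_of_mem (hU.mem_nhds hx) h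
  rw [pd, pd, huv.fderiv_eq]

theorem isSymmSndFDerivAt_of_contDiffAt {E : Type*} [NormedAddCommGroup E] [NormedSpace ℝ E]
    {F : E → ℝ} {q : E} (hF : ContDiffAt ℝ ∞ F q) : IsSymmSndFDerivAt ℝ F q :=
  hF.isSymmSndFDerivAt (by simpa using (WithTop.coe_le_coe.2 le_top : (((2 : ℕ∞) : ℕ∞ω)) ≤ ∞))

theorem pd_comm (hU : IsOpen U) (hu : ContDiffOn ℝ ∞ u U) (hx : x ∈ U) (i j : Fin 3) :
    pd i (pd j u) x = pd j (pd i u) x := by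
  have hc : ContDiffAt ℝ ∞ u x := hu.contDiffAt (hU.mem_nhds hx)
  have hd : DifferentiableAt ℝ (fderiv ℝ u) x :=
    (hc.fderiv_right (m := ∞) (by simp)).differentiableAt (by simp)
  have pd_pd : ∀ k l : Fin 3, pd k (pd l u) x =
      fderiv ℝ (fderiv ℝ u) x (EuclideanSpace.single k 1) (EuclideanSpace.single l 1) := by
    intro k l
    unfold pd
    rw [fderiv_clm_apply hd (differentiableAt_const _)]
    simp
  rw [pd_pd, pd_pd]
  exact isSymmSndFDerivAt_of_contDiffAt hc _ _

theorem pd_eq_zero_of_eqOn_compl (hK : IsClosed K) (h : ∀ y ∉ K, u y = 0) (hx : x ∉ K)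
    (i : Fin 3) : pd i u x = 0 := by
  rw [pd_congr hK.isOpen_compl (v := fun _ => 0) h hx]
  exact (HasGrad.const 0).pd_eq i

theorem contDiff_of_eqOn_compl {n : ℕ∞ω} (hU : IsOpen U) (hu : ContDiffOn ℝ n u U)
    (hK : IsClosed K) (hKU : K ⊆ U) (h : ∀ y ∉ K, u y = 0) : ContDiff ℝ n u := by
  rw [contDiff_iff_contDiffAt]
  intro x
  by_cases hx : x ∈ K
  · exact hu.contDiffAt (hU.mem_nhds (hKU hx))
  · exact (contDiffAt_const (c := (0 : ℝ))).congr_of_eventuallyEq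
      (Filter.eventually_of_mem (hK.isOpen_compl.mem_nhds hx) h)

theorem integrable_of_eqOn_compl (hU : IsOpen U) (hu : ContDiffOn ℝ ∞ u U)
    (hK : IsCompact K) (hKU : K ⊆ U) (h : ∀ y ∉ K, u y = 0) : Integrable u :=
  (contDiff_of_eqOn_compl hU hu hK.isClosed hKU h).continuous.integrable_of_hasCompactSupport
    (HasCompactSupport.intro hK h)

theorem integral_pd_eq_zero (hU : IsOpen U) (hu : ContDiffOn ℝ ∞ u U)
    (hK : IsCompact K) (hKU : K ⊆ U) (h : ∀ y ∉ K, u y = 0) (i : Fin 3) :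
    ∫ x, pd i u x = 0 := by
  have hc := contDiff_of_eqOn_compl hU hu hK.isClosed hKU h
  have hi := integrable_of_eqOn_compl hU hu hK hKU h
  have hi' : Integrable (pd i u) := integrable_of_eqOn_compl hU (contDiffOn_pd hU hu i) hK hKU
    fun y hy => pd_eq_zero_of_eqOn_compl hK.isClosed h hy i
  have := integral_mul_fderiv_eq_neg_fderiv_mul_of_integrable (μ := (volume : Measure E3))
    (f := fun _ : E3 => (1 : ℝ)) (g := u) (v := EuclideanSpace.single i 1)
    (by simp) (by simp only [one_mul]; exact hi') (by simpa using hi) (by simp)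
    (fun x _ => hc.differentiable (by simp) x)
  simpa [pd] using this

theorem exists_eq_const_of_pd_eq_zero (hU : IsOpen U) (hUc : IsPreconnected U)
    (hu : ContDiffOn ℝ ∞ u U) (h : ∀ x ∈ U, ∀ i, pd i u x = 0) : ∃ c, ∀ x ∈ U, u x = c := by
  refine hU.exists_is_const_of_fderiv_eq_zero hUc (hu.differentiableOn (by simp)) fun x hx => ?_
  refine ContinuousLinearMap.coe_injective
    ((EuclideanSpace.basisFun (Fin 3) ℝ).toBasis.ext fun i => ?_)
  simpa [pd] using h x hx i

theorem norm_sq_eq_sum (x : E3) : ‖x‖ ^ 2 = x 0 ^ 2 + x 1 ^ 2 + x 2 ^ 2 := by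
  rw [EuclideanSpace.norm_sq_eq]; simp [Fin.sum_univ_three]

theorem pd_slice {F : ℝ × E3 → ℝ} {t : ℝ} (hF : DifferentiableAt ℝ F (t, x)) (k : Fin 3) :
    pd k (fun y => F (t, y)) x = fderiv ℝ F (t, x) (0, EuclideanSpace.single k 1) := by
  have hy : HasFDerivAt (fun y : E3 => (t, y)) (ContinuousLinearMap.inr ℝ ℝ E3) x :=
    (hasFDerivAt_const t x).prodMk (hasFDerivAt_id x)
  have h : HasFDerivAt (fun y => F (t, y)) _ x := hF.hasFDerivAt.comp x hy
  rw [pd, h.fderiv]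
  simp

theorem hasDerivAt_pd_slice {F : ℝ × E3 → ℝ} (hF : ContDiffAt ℝ ∞ F (0, x)) (k : Fin 3) :
    HasDerivAt (fun t => pd k (fun y => F (t, y)) x)
      (pd k (fun y => deriv (fun t => F (t, y)) 0) x) 0 := by
  have hd : DifferentiableAt ℝ (fderiv ℝ F) (0, x) :=
    (hF.fderiv_right (m := ∞) (by simp)).differentiableAt (by simp)
  have hev : ∀ᶠ q in 𝓝 ((0 : ℝ), x), DifferentiableAt ℝ F q := by
    filter_upwards [(hF.of_le (m := 1) (by simp)).eventually (by simp)] with q hq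
    exact hq.differentiableAt (by simp)
  have hE : HasFDerivAt (fun y : E3 => ((0 : ℝ), y)) (ContinuousLinearMap.inr ℝ ℝ E3) x :=
    (ContinuousLinearMap.inr ℝ ℝ E3).hasFDerivAt
  have hT : ∀ y : E3, HasDerivAt (fun t : ℝ => (t, y)) ((1 : ℝ), (0 : E3)) 0 := fun y =>
    (hasDerivAt_id (0 : ℝ)).prodMk (hasDerivAt_const 0 y)
  have hpd : (fun t => pd k (fun y => F (t, y)) x) =ᶠ[𝓝 0]
      fun t => fderiv ℝ F (t, x) (0, EuclideanSpace.single k 1) := by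
    filter_upwards [(hT x).continuousAt.eventually hev] with t ht
    exact pd_slice ht k
  have hderiv : (fun y => deriv (fun t => F (t, y)) 0) =ᶠ[𝓝 x]
      fun y => fderiv ℝ F (0, y) (1, 0) := by
    filter_upwards [hE.continuousAt.eventually hev] with y hy
    exact (hy.hasFDerivAt.comp_hasDerivAt (0 : ℝ) (hT y)).deriv
  have hL : HasDerivAt (fun t => fderiv ℝ F (t, x) (0, EuclideanSpace.single k 1))
      (fderiv ℝ (fderiv ℝ F) (0, x) (1, 0) (0, EuclideanSpace.single k 1)) 0 := by
    have := hd.hasFDerivAt.comp_hasDerivAt (0 : ℝ) (hT x)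
    simpa using this.clm_apply
      (hasDerivAt_const (0 : ℝ) ((0 : ℝ), EuclideanSpace.single k (1 : ℝ)))
  have hR : pd k (fun y => deriv (fun t => F (t, y)) 0) x =
      fderiv ℝ (fderiv ℝ F) (0, x) (0, EuclideanSpace.single k 1) (1, 0) := by
    have h := (hd.hasFDerivAt.comp x hE).clm_apply (hasFDerivAt_const ((1 : ℝ), (0 : E3)) x)
    rw [pd, hderiv.fderiv_eq]
    refine Eq.trans (congrArg (· (EuclideanSpace.single k 1)) h.fderiv) ?_
    simp
  rw [hR, isSymmSndFDerivAt_of_contDiffAt hF]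
  exact hL.congr_of_eventuallyEq hpd

end Calculus

/-! ### Metrics and their Levi-Civita connection -/

section Metric

/-- `g` is a smooth pseudo-Riemannian metric on the open set `U`. Instead of positive definiteness
only positivity of the determinant is required, which is what makes `g⁻¹` and `√(det g)` smooth. -/
structure IsMetricOn (g : Tensor2) (U : Set E3) : Prop where
  isOpen : IsOpen U
  smooth : ∀ i j, ContDiffOn ℝ ∞ (fun x => g x i j) U
  symm : ∀ x ∈ U, ∀ i j, g x i j = g x j i
  det_pos : ∀ x ∈ U, 0 < (g x).det

section MatrixFields

variable {E : Type*} [NormedAddCommGroup E] [NormedSpace ℝ E] {M : E → Matrix (Fin 3) (Fin 3) ℝ}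
  {q : E}

theorem contDiffAt_det (hM : ∀ i j, ContDiffAt ℝ ∞ (fun z => M z i j) q) :
    ContDiffAt ℝ ∞ (fun z => (M z).det) q := by
  simp only [Matrix.det_fin_three]
  fun_prop

theorem contDiffAt_inv (hM : ∀ i j, ContDiffAt ℝ ∞ (fun z => M z i j) q)
    (h0 : (M q).det ≠ 0) (i j : Fin 3) : ContDiffAt ℝ ∞ (fun z => (M z)⁻¹ i j) q := by
  simp only [Matrix.inv_def, Ring.inverse_eq_inv', Matrix.smul_apply, smul_eq_mul,
    Matrix.adjugate_apply]
  refine ((contDiffAt_det hM).inv h0).mul (contDiffAt_det fun a b => ?_)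
  by_cases hab : a = j
  · subst hab; simpa using contDiffAt_const
  · simpa [Matrix.updateRow_apply, hab] using hM a b

end MatrixFields

namespace IsMetricOn

variable {g : Tensor2} {U V : Set E3} {x : E3}

theorem mono (hg : IsMetricOn g U) (hV : IsOpen V) (hVU : V ⊆ U) : IsMetricOn g V where
  isOpen := hV
  smooth i j := (hg.smooth i j).mono hVU
  symm x hx := hg.symm x (hVU hx)
  det_pos x hx := hg.det_pos x (hVU hx)

theorem isUnit_det (hg : IsMetricOn g U) (hx : x ∈ U) : IsUnit (g x).det :=
  (hg.det_pos x hx).ne'.isUnit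

theorem transpose_eq (hg : IsMetricOn g U) (hx : x ∈ U) : (g x).transpose = g x :=
  Matrix.ext fun i j => hg.symm x hx j i

theorem hasGrad (hg : IsMetricOn g U) (hx : x ∈ U) (i j : Fin 3) :
    HasGrad (fun y => g y i j) (fun k => pd k (fun y => g y i j) x) x :=
  hasGrad_of_contDiffOn hg.isOpen (hg.smooth i j) hx

theorem sum_mul_ginv (hg : IsMetricOn g U) (hx : x ∈ U) (i j : Fin 3) :
    ∑ k, g x i k * ginv g x k j = if i = j then 1 else 0 := by
  rw [← Matrix.one_apply, ← Matrix.mul_nonsing_inv _ (hg.isUnit_det hx), Matrix.mul_apply]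
  rfl

theorem ginv_symm (hg : IsMetricOn g U) (hx : x ∈ U) (i j : Fin 3) :
    ginv g x i j = ginv g x j i := by
  rw [ginv, ← Matrix.transpose_apply (g x)⁻¹, Matrix.transpose_nonsing_inv, hg.transpose_eq hx,
    ginv]

theorem contDiffOn_ginv (hg : IsMetricOn g U) (i j : Fin 3) :
    ContDiffOn ℝ ∞ (fun x => ginv g x i j) U := fun x hx =>
  (contDiffAt_inv (fun a b => (hg.smooth a b).contDiffAt (hg.isOpen.mem_nhds hx))
    (hg.det_pos x hx).ne' i j).contDiffWithinAt

theorem contDiffOn_volDensity (hg : IsMetricOn g U) : ContDiffOn ℝ ∞ (volDensity g) U :=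
  fun x hx => (ContDiffAt.sqrt (contDiffAt_det fun a b =>
    (hg.smooth a b).contDiffAt (hg.isOpen.mem_nhds hx)) (hg.det_pos x hx).ne').contDiffWithinAt

theorem volDensity_pos (hg : IsMetricOn g U) (hx : x ∈ U) : 0 < volDensity g x :=
  Real.sqrt_pos.2 (hg.det_pos x hx)

theorem contDiffOn_christoffel (hg : IsMetricOn g U) (k i j : Fin 3) :
    ContDiffOn ℝ ∞ (christoffel g k i j) U := by
  have hp := fun a b c => contDiffOn_pd hg.isOpen (hg.smooth b c) a
  exact contDiffOn_const.mul (ContDiffOn.sum fun l _ =>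
    (hg.contDiffOn_ginv k l).mul (((hp i j l).add (hp j i l)).sub (hp l i j)))

theorem hasGrad_christoffel (hg : IsMetricOn g U) (hx : x ∈ U) (k i j : Fin 3) :
    HasGrad (christoffel g k i j) (fun l => pd l (christoffel g k i j) x) x :=
  hasGrad_of_contDiffOn hg.isOpen (hg.contDiffOn_christoffel k i j) hx

theorem christoffel_symm (hg : IsMetricOn g U) (hx : x ∈ U) (k i j : Fin 3) :
    christoffel g k i j x = christoffel g k j i x := by
  unfold christoffel
  congr 1
  refine Finset.sum_congr rfl fun l _ => ?_
  rw [pd_congr hg.isOpen (fun y hy => hg.symm y hy i j) hx l]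
  ring

theorem sum_mul_christoffel (hg : IsMetricOn g U) (hx : x ∈ U) (l i j : Fin 3) :
    ∑ k, g x l k * christoffel g k i j x = (1 / 2) *
      (pd i (fun y => g y j l) x + pd j (fun y => g y i l) x - pd l (fun y => g y i j) x) := by
  set d : Fin 3 → ℝ := fun n =>
    pd i (fun y => g y j n) x + pd j (fun y => g y i n) x - pd n (fun y => g y i j) x
  calc ∑ k, g x l k * christoffel g k i j x
      = ∑ k, g x l k * ((1 / 2) * ∑ n, ginv g x k n * d n) := rfl
    _ = (1 / 2) * ∑ n, (∑ k, g x l k * ginv g x k n) * d n := by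
        simp only [Fin.sum_univ_three]; ring
    _ = (1 / 2) * d l := by simp only [hg.sum_mul_ginv hx, ite_mul, one_mul, zero_mul,
        Finset.sum_ite_eq, Finset.mem_univ, if_true]

theorem pd_metric (hg : IsMetricOn g U) (hx : x ∈ U) (k i j : Fin 3) :
    pd k (fun y => g y i j) x =
      ∑ l, (christoffel g l k i x * g x l j + g x i l * christoffel g l k j x) := by
  have hij := hg.sum_mul_christoffel hx i k j
  have hji := hg.sum_mul_christoffel hx j k i
  have hs := fun l => pd_congr hg.isOpen (fun y hy => hg.symm y hy j i) hx l
  have hs' := pd_congr hg.isOpen (fun y hy => hg.symm y hy k j) hx i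
  have hs'' := pd_congr hg.isOpen (fun y hy => hg.symm y hy k i) hx j
  simp only [Finset.sum_add_distrib, hg.symm x hx _ j, mul_comm _ (g x j _), hij, hji, hs, hs',
    hs'']
  ring

theorem pd_ginv (hg : IsMetricOn g U) (hx : x ∈ U) (k i j : Fin 3) :
    pd k (fun y => ginv g y i j) x =
      -∑ l, (ginv g x i l * christoffel g j k l x + christoffel g i k l x * ginv g x l j) := by
  set D : Matrix (Fin 3) (Fin 3) ℝ := Matrix.of fun i j => pd k (fun y => ginv g y i j) x
  set C : Matrix (Fin 3) (Fin 3) ℝ := Matrix.of fun i j => christoffel g j k i x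
  have hgC : Matrix.of (fun i j => pd k (fun y => g y i j) x) = C * g x + g x * C.transpose := by
    ext a b
    simp only [Matrix.of_apply, hg.pd_metric hx, Finset.sum_add_distrib, Matrix.add_apply,
      Matrix.mul_apply, Matrix.transpose_apply, C]
  have hleibniz : D * g x + (g x)⁻¹ * (C * g x + g x * C.transpose) = 0 := by
    rw [← hgC]
    ext a b
    have hsum := HasGrad.sum Finset.univ (x := x) fun c (_ : c ∈ Finset.univ) =>
      (hasGrad_of_contDiffOn hg.isOpen (hg.contDiffOn_ginv a c) hx).mul (hg.hasGrad hx c b)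
    have hconst := (HasGrad.const (x := x) ((1 : Matrix (Fin 3) (Fin 3) ℝ) a b)).congr_of_eqOn
      hg.isOpen hx (v := fun y => ∑ c, ginv g y a c * g y c b) fun y hy => by
        rw [← Matrix.nonsing_inv_mul _ (hg.isUnit_det hy), Matrix.mul_apply]
        rfl
    have h := (hsum.pd_eq k).symm.trans (hconst.pd_eq k)
    exact Finset.sum_add_distrib.symm.trans h
  have hD : D = -((g x)⁻¹ * C + C.transpose * (g x)⁻¹) := by
    calc D = D * g x * (g x)⁻¹ := (Matrix.mul_nonsing_inv_cancel_right _ _ (hg.isUnit_det hx)).symm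
      _ = -((g x)⁻¹ * (C * g x + g x * C.transpose)) * (g x)⁻¹ := by
        rw [eq_neg_of_add_eq_zero_left hleibniz]
      _ = _ := by
        rw [mul_add, ← mul_assoc, ← mul_assoc, Matrix.nonsing_inv_mul _ (hg.isUnit_det hx), one_mul,
          neg_mul, add_mul, Matrix.mul_nonsing_inv_cancel_right _ _ (hg.isUnit_det hx)]
  calc pd k (fun y => ginv g y i j) x = D i j := rfl
    _ = _ := by
      rw [hD, Finset.sum_add_distrib]
      rfl

theorem hasGrad_ginv (hg : IsMetricOn g U) (hx : x ∈ U) (i j : Fin 3) :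
    HasGrad (fun y => ginv g y i j) (fun k => -∑ l, (ginv g x i l * christoffel g j k l x
      + christoffel g i k l x * ginv g x l j)) x :=
  (hasGrad_of_contDiffOn hg.isOpen (hg.contDiffOn_ginv i j) hx).congr_grad
    fun k => hg.pd_ginv hx k i j

theorem hasGrad_det (hg : IsMetricOn g U) (hx : x ∈ U) :
    HasGrad (fun y => (g y).det) (fun k => 2 * (g x).det * ∑ l, christoffel g l k l x) x := by
  have hprod := fun a b c d e f =>
    ((hg.hasGrad hx a b).mul (hg.hasGrad hx c d)).mul (hg.hasGrad hx e f)
  have h := (((((hprod 0 0 1 1 2 2).sub (hprod 0 0 1 2 2 1)).sub (hprod 0 1 1 0 2 2)).add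
    (hprod 0 1 1 2 2 0)).add (hprod 0 2 1 0 2 1)).sub (hprod 0 2 1 1 2 0)
  simp only [Matrix.det_fin_three]
  refine h.congr_grad fun k => ?_
  simp only [hg.pd_metric hx, Fin.sum_univ_three]
  ring

theorem hasGrad_volDensity (hg : IsMetricOn g U) (hx : x ∈ U) :
    HasGrad (volDensity g) (fun k => volDensity g x * ∑ l, christoffel g l k l x) x := by
  have h0 := hg.det_pos x hx
  refine ((hg.hasGrad_det hx).comp_hasDerivAt (Real.hasDerivAt_sqrt h0.ne')).congr_grad fun k => ?_
  have hs := (Real.sqrt_pos.2 h0).ne'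
  rw [volDensity]
  field_simp [hs]
  rw [Real.sq_sqrt h0.le]

theorem contDiffOn_ricci (hg : IsMetricOn g U) (i j : Fin 3) :
    ContDiffOn ℝ ∞ (fun x => ricci g x i j) U := by
  have hΓ := hg.contDiffOn_christoffel
  have hp := fun l k i j => contDiffOn_pd hg.isOpen (hΓ k i j) l
  exact ContDiffOn.sum fun k _ => ((hp k k i j).sub (hp j k i k)).add
    (ContDiffOn.sum fun l _ => ((hΓ k k l).mul (hΓ l i j)).sub ((hΓ k j l).mul (hΓ l i k)))

theorem sum_pd_christoffel_symm (hg : IsMetricOn g U) (hx : x ∈ U) (i j : Fin 3) :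
    ∑ k, pd j (christoffel g k i k) x = ∑ k, pd i (christoffel g k j k) x := by
  have hv := hg.volDensity_pos hx
  have hpd : ∀ i j, pd j (pd i (volDensity g)) x = volDensity g x *
      ((∑ l, christoffel g l j l x) * ∑ l, christoffel g l i l x)
        + volDensity g x * ∑ k, pd j (christoffel g k i k) x := by
    intro i j
    refine (((hg.hasGrad_volDensity hx).mul (HasGrad.sum Finset.univ fun k _ =>
      hg.hasGrad_christoffel hx k i k)).congr_of_eqOn hg.isOpen hx fun y hy =>
        (hg.hasGrad_volDensity hy).pd_eq i).pd_eq j |>.trans ?_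
    ring
  have hcomm := pd_comm hg.isOpen hg.contDiffOn_volDensity hx i j
  rw [hpd, hpd] at hcomm
  exact mul_left_cancel₀ hv.ne' (by linear_combination -hcomm)

theorem ricci_symm (hg : IsMetricOn g U) (hx : x ∈ U) (i j : Fin 3) :
    ricci g x i j = ricci g x j i := by
  have hdiv := hg.sum_pd_christoffel_symm hx i j
  have hcongr : ∀ k l, pd l (christoffel g k i j) x = pd l (christoffel g k j i) x := fun k l =>
    pd_congr hg.isOpen (fun y hy => hg.christoffel_symm hy k i j) hx l
  have hquad : ∑ k, ∑ l, christoffel g k j l x * christoffel g l i k x =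
      ∑ k, ∑ l, christoffel g k i l x * christoffel g l j k x := by
    rw [Finset.sum_comm]
    simp only [mul_comm]
  simp only [ricci, Finset.sum_add_distrib, Finset.sum_sub_distrib, hdiv, hcongr, hquad,
    hg.christoffel_symm hx _ i j]

end IsMetricOn

end Metric

/-! ### First variation of the curvature and of the constraint map -/

section FirstVariation

/-- Smooth symmetric 2-tensor fields on all of space: the directions of variation. -/
structure IsSmoothSymm (h : Tensor2) : Prop where
  smooth : ∀ i j, ContDiff ℝ ∞ (fun x => h x i j)
  symm : ∀ x i j, h x i j = h x j i

theorem IsTest.isSmoothSymm {H : Set E3} {h : Tensor2} (hh : IsTest H h) : IsSmoothSymm h :=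
  ⟨hh.smooth, hh.symm⟩

variable {g h w : Tensor2} {U : Set E3} {x : E3}

theorem IsSmoothSymm.hasGrad (hh : IsSmoothSymm h) (x : E3) (i j : Fin 3) :
    HasGrad (fun y => h y i j) (fun k => pd k (fun y => h y i j) x) x :=
  .of_differentiableAt ((hh.smooth i j).differentiable (by simp) x)

theorem hasDerivAt_id_mul {q : ℝ → ℝ} (hq : DifferentiableAt ℝ q 0) :
    HasDerivAt (fun t => t * q t) (q 0) 0 := by
  simpa using (hasDerivAt_id' (0 : ℝ)).fun_mul hq.hasDerivAt

theorem add_smul_apply (g h : Tensor2) (t : ℝ) (y : E3) (i j : Fin 3) :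
    (g + t • h) y i j = g y i j + t * h y i j := rfl

theorem tensor_smul_apply (t : ℝ) (h : Tensor2) (y : E3) (i j : Fin 3) :
    (t • h) y i j = t * h y i j := rfl

theorem contDiffAt_ginv_add_smul (hg : IsMetricOn g U) (hh : IsSmoothSymm h) (hx : x ∈ U)
    (i j : Fin 3) :
    ContDiffAt ℝ ∞ (fun q : ℝ × E3 => ginv (g + q.1 • h) q.2 i j) (0, x) := by
  refine contDiffAt_inv (M := fun q : ℝ × E3 => (g + q.1 • h) q.2) (fun a b => ?_) ?_ i j
  · have h1 : ContDiffAt ℝ ∞ (fun q : ℝ × E3 => g q.2 a b) (0, x) :=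
      ((hg.smooth a b).contDiffAt (hg.isOpen.mem_nhds hx)).comp ((0 : ℝ), x) contDiffAt_snd
    have h2 : ContDiffAt ℝ ∞ (fun q : ℝ × E3 => h q.2 a b) (0, x) :=
      (hh.smooth a b).contDiffAt.comp ((0 : ℝ), x) contDiffAt_snd
    exact h1.add (contDiffAt_fst.mul h2)
  · simpa using (hg.det_pos x hx).ne'

theorem pd_add_smul (hg : IsMetricOn g U) (hh : IsSmoothSymm h) (hx : x ∈ U) (t : ℝ)
    (k i j : Fin 3) : pd k (fun y => (g + t • h) y i j) x =
      pd k (fun y => g y i j) x + t * pd k (fun y => h y i j) x :=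
  ((hg.hasGrad hx i j).add ((hh.hasGrad x i j).const_mul t)).pd_eq k

theorem contDiffAt_christoffel_add_smul (hg : IsMetricOn g U) (hh : IsSmoothSymm h) (hx : x ∈ U)
    (k i j : Fin 3) :
    ContDiffAt ℝ ∞ (fun q : ℝ × E3 => christoffel (g + q.1 • h) k i j q.2) (0, x) := by
  have hp : ∀ a b c, ContDiffAt ℝ ∞
      (fun q : ℝ × E3 => pd a (fun y => (g + q.1 • h) y b c) q.2) (0, x) := by
    intro a b c
    have h1 : ContDiffAt ℝ ∞ (fun q : ℝ × E3 => pd a (fun y => g y b c) q.2) (0, x) :=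
      ((contDiffOn_pd hg.isOpen (hg.smooth b c) a).contDiffAt (hg.isOpen.mem_nhds hx)).comp
        ((0 : ℝ), x) contDiffAt_snd
    have h2 : ContDiffAt ℝ ∞ (fun q : ℝ × E3 => pd a (fun y => h y b c) q.2) (0, x) :=
      ((contDiffOn_pd isOpen_univ (hh.smooth b c).contDiffOn a).contDiffAt Filter.univ_mem).comp
        ((0 : ℝ), x) contDiffAt_snd
    refine (h1.add (contDiffAt_fst.mul h2)).congr_of_eventuallyEq ?_
    have : ∀ᶠ q : ℝ × E3 in 𝓝 (0, x), q.2 ∈ U :=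
      continuous_snd.continuousAt.eventually_mem (hg.isOpen.mem_nhds hx)
    filter_upwards [this] with q hq
    exact pd_add_smul hg hh hq q.1 a b c
  unfold christoffel
  exact contDiffAt_const.mul (ContDiffAt.sum fun l _ =>
    (contDiffAt_ginv_add_smul hg hh hx k l).mul (((hp i j l).add (hp j i l)).sub (hp l i j)))

theorem differentiableAt_ginv_add_smul (hg : IsMetricOn g U) (hh : IsSmoothSymm h) (hx : x ∈ U)
    (i j : Fin 3) : DifferentiableAt ℝ (fun t : ℝ => ginv (g + t • h) x i j) 0 :=
  DifferentiableAt.comp (0 : ℝ) (f := fun t : ℝ => (t, x))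
    ((contDiffAt_ginv_add_smul hg hh hx i j).differentiableAt (by simp)) (by fun_prop)

theorem differentiableAt_christoffel_add_smul (hg : IsMetricOn g U) (hh : IsSmoothSymm h)
    (hx : x ∈ U) (k i j : Fin 3) :
    DifferentiableAt ℝ (fun t : ℝ => christoffel (g + t • h) k i j x) 0 :=
  DifferentiableAt.comp (0 : ℝ) (f := fun t : ℝ => (t, x))
    ((contDiffAt_christoffel_add_smul hg hh hx k i j).differentiableAt (by simp)) (by fun_prop)

theorem hasDerivAt_ginv_add_smul (hg : IsMetricOn g U) (hh : IsSmoothSymm h) (hx : x ∈ U)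
    (i j : Fin 3) :
    HasDerivAt (fun t : ℝ => ginv (g + t • h) x i j)
      (-∑ a, ∑ b, ginv g x i a * h x a b * ginv g x b j) 0 := by
  have hdet : ∀ᶠ t : ℝ in 𝓝 0, IsUnit ((g + t • h) x).det := by
    have hc : Continuous fun t : ℝ => ((g + t • h) x).det := by
      simp only [Matrix.det_fin_three, add_smul_apply]; fun_prop
    simp only [isUnit_iff_ne_zero]
    exact hc.continuousAt.eventually_ne (by simpa using (hg.det_pos x hx).ne')
  have hB : DifferentiableAt ℝ
      (fun t : ℝ => ∑ a, ∑ b, ginv (g + t • h) x i a * h x a b * ginv g x b j) 0 :=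
    DifferentiableAt.fun_sum fun a _ => DifferentiableAt.fun_sum fun b _ =>
      ((differentiableAt_ginv_add_smul hg hh hx i a).mul_const _).mul_const _
  have hderiv := (hasDerivAt_id_mul hB).const_sub (ginv g x i j)
  simp only [zero_smul, add_zero] at hderiv
  refine hderiv.congr_of_eventuallyEq ?_
  filter_upwards [hdet] with t ht
  have hresolvent : ((g + t • h) x)⁻¹ =
      (g x)⁻¹ - t • (((g + t • h) x)⁻¹ * h x * (g x)⁻¹) := by
    have hunit : IsUnit ((g + t • h) x) ↔ IsUnit (g x) := by
      simp only [Matrix.isUnit_iff_isUnit_det, ht, hg.isUnit_det hx]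
    have hsub : g x - (g + t • h) x = -(t • h x) := sub_add_cancel_left _ _
    rw [sub_eq_add_neg, ← sub_eq_iff_eq_add', Matrix.inv_sub_inv hunit, hsub, mul_neg, neg_mul,
      mul_smul_comm, smul_mul_assoc]
  have hij := congrFun (congrFun hresolvent i) j
  simp only [ginv]
  rw [hij]
  simp only [Matrix.sub_apply, Matrix.smul_apply, Matrix.mul_apply, smul_eq_mul, Finset.sum_mul]
  rw [Finset.sum_comm]

/-- The first variation `½ g^{kl} (∇_i h_{jl} + ∇_j h_{il} - ∇_l h_{ij})` of `Γ^k_{ij}`. -/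
def varChristoffel (g h : Tensor2) (k i j : Fin 3) (x : E3) : ℝ :=
  (1 / 2) * ∑ l, ginv g x k l * (covDeriv g h x i j l + covDeriv g h x j i l - covDeriv g h x l i j)

theorem covDeriv_add_sub (hg : IsMetricOn g U) (hh : IsSmoothSymm h) (hx : x ∈ U)
    (i j l : Fin 3) :
    covDeriv g h x i j l + covDeriv g h x j i l - covDeriv g h x l i j =
      pd i (fun y => h y j l) x + pd j (fun y => h y i l) x - pd l (fun y => h y i j) x
        - 2 * ∑ b, h x l b * christoffel g b i j x := by
  simp only [covDeriv, Fin.sum_univ_three, hg.christoffel_symm hx _ j i,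
    hg.christoffel_symm hx _ l i, hg.christoffel_symm hx _ l j, hh.symm x _ l, hh.symm x _ j]
  ring

theorem hasDerivAt_christoffel (hg : IsMetricOn g U) (hh : IsSmoothSymm h) (hx : x ∈ U)
    (k i j : Fin 3) :
    HasDerivAt (fun t : ℝ => christoffel (g + t • h) k i j x) (varChristoffel g h k i j x) 0 := by
  have hp : ∀ a b c, HasDerivAt (fun t : ℝ => pd a (fun y => (g + t • h) y b c) x)
      (pd a (fun y => h y b c) x) 0 := by
    intro a b c
    simp only [pd_add_smul hg hh hx]
    simpa using ((hasDerivAt_id (0 : ℝ)).mul_const (pd a (fun y => h y b c) x)).const_add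
      (pd a (fun y => g y b c) x)
  have hderiv := (HasDerivAt.fun_sum (u := Finset.univ) fun l _ =>
    (hasDerivAt_ginv_add_smul hg hh hx k l).fun_mul
      (((hp i j l).fun_add (hp j i l)).fun_sub (hp l i j))).const_mul (1 / 2 : ℝ)
  refine hderiv.congr_deriv ?_
  have hvar_ginv : ∑ l, (∑ a, ∑ b, ginv g x k a * h x a b * ginv g x b l) *
      (pd i (fun y => g y j l) x + pd j (fun y => g y i l) x - pd l (fun y => g y i j) x)
      = 2 * ∑ l, ginv g x k l * ∑ b, h x l b * christoffel g b i j x := by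
    simp only [christoffel, Fin.sum_univ_three]
    ring
  simp only [zero_smul, add_zero, varChristoffel, covDeriv_add_sub hg hh hx]
  simp only [Fin.sum_univ_three] at hvar_ginv ⊢
  linear_combination (-1 / 2 : ℝ) * hvar_ginv

/-- The first variation of the component `R_{ij}` of the Ricci tensor. -/
def varRicci (g h : Tensor2) (x : E3) (i j : Fin 3) : ℝ :=
  ∑ k, (pd k (varChristoffel g h k i j) x - pd j (varChristoffel g h k i k) x
    + ∑ l, ((varChristoffel g h k k l x * christoffel g l i j x
        + christoffel g k k l x * varChristoffel g h l i j x)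
      - (varChristoffel g h k j l x * christoffel g l i k x
        + christoffel g k j l x * varChristoffel g h l i k x)))

theorem hasDerivAt_pd_christoffel (hg : IsMetricOn g U) (hh : IsSmoothSymm h) (hx : x ∈ U)
    (n k i j : Fin 3) :
    HasDerivAt (fun t : ℝ => pd n (christoffel (g + t • h) k i j) x)
      (pd n (varChristoffel g h k i j) x) 0 := by
  have := hasDerivAt_pd_slice (contDiffAt_christoffel_add_smul hg hh hx k i j) n
  rwa [pd_congr hg.isOpen (v := varChristoffel g h k i j)
    (fun y hy => (hasDerivAt_christoffel hg hh hy k i j).deriv) hx] at this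

theorem hasDerivAt_ricci (hg : IsMetricOn g U) (hh : IsSmoothSymm h) (hx : x ∈ U)
    (i j : Fin 3) :
    HasDerivAt (fun t : ℝ => ricci (g + t • h) x i j) (varRicci g h x i j) 0 := by
  have hc := fun k i j => hasDerivAt_christoffel hg hh hx k i j
  have hp := fun n k i j => hasDerivAt_pd_christoffel hg hh hx n k i j
  have hderiv := HasDerivAt.fun_sum (u := Finset.univ) fun k _ =>
    ((hp k k i j).fun_sub (hp j k i k)).fun_add (HasDerivAt.fun_sum (u := Finset.univ) fun l _ =>
      ((hc k k l).fun_mul (hc l i j)).fun_sub ((hc k j l).fun_mul (hc l i k)))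
  simp only [zero_smul, add_zero] at hderiv
  exact hderiv

theorem hasDerivAt_scalarCurv (hg : IsMetricOn g U) (hh : IsSmoothSymm h) (hx : x ∈ U) :
    HasDerivAt (fun t : ℝ => scalarCurv (g + t • h) x)
      (∑ i, ∑ j, ((-∑ a, ∑ b, ginv g x i a * h x a b * ginv g x b j) * ricci g x i j
        + ginv g x i j * varRicci g h x i j)) 0 := by
  have hderiv := HasDerivAt.fun_sum (u := Finset.univ) fun i _ =>
    HasDerivAt.fun_sum (u := Finset.univ) fun j _ =>
      (hasDerivAt_ginv_add_smul hg hh hx i j).fun_mul (hasDerivAt_ricci hg hh hx i j)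
  simp only [zero_smul, add_zero] at hderiv
  exact hderiv

theorem traceAt_smul (g p : Tensor2) (t : ℝ) (x : E3) :
    traceAt g (t • p) x = t * traceAt g p x := by
  simp only [traceAt, tensor_smul_apply, Finset.mul_sum, mul_left_comm t]

theorem inner2_smul_smul (g : Tensor2) (x : E3) (t : ℝ) (A B : Matrix (Fin 3) (Fin 3) ℝ) :
    inner2 g x (t • A) (t • B) = t * (t * inner2 g x A B) := by
  simp only [inner2, Matrix.smul_apply, smul_eq_mul, Finset.mul_sum]
  refine Finset.sum_congr rfl fun i _ => Finset.sum_congr rfl fun j _ =>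
    Finset.sum_congr rfl fun k _ => Finset.sum_congr rfl fun l _ => ?_
  ring

theorem divergence_smul (g : Tensor2) (hw : IsSmoothSymm w) (t : ℝ) (x : E3) (i : Fin 3) :
    divergence g (t • w) x i = t * divergence g w x i := by
  have hpd : ∀ j k l, pd j (fun y => (t • w) y k l) x = t * pd j (fun y => w y k l) x :=
    fun j k l => ((hw.hasGrad x k l).const_mul t).pd_eq j
  simp only [divergence, covDeriv, hpd]
  simp only [tensor_smul_apply, mul_left_comm _ t, ← mul_add, ← Finset.mul_sum, ← mul_sub]

theorem DPhi_fst (hg : IsMetricOn g U) (hh : IsSmoothSymm h) (hx : x ∈ U) :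
    (DPhi g 0 h w x).1 =
      ∑ i, ∑ j, ((-∑ a, ∑ b, ginv g x i a * h x a b * ginv g x b j) * ricci g x i j
        + ginv g x i j * varRicci g h x i j) := by
  have hG := differentiableAt_ginv_add_smul hg hh hx
  have htrace : DifferentiableAt ℝ (fun t : ℝ => t * traceAt (g + t • h) w x ^ 2) 0 := by
    unfold traceAt
    fun_prop
  have hinner : DifferentiableAt ℝ
      (fun t : ℝ => t * inner2 (g + t • h) x (w x) (w x)) 0 := by
    unfold inner2
    fun_prop
  have hderiv := ((hasDerivAt_scalarCurv hg hh hx).fun_add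
    ((hasDerivAt_id_mul htrace).const_mul (1 / 2 : ℝ))).fun_sub (hasDerivAt_id_mul hinner)
  simp only [zero_mul, mul_zero, add_zero, sub_zero] at hderiv
  refine Eq.trans ?_ hderiv.deriv
  simp only [DPhi, Phi, hamiltonian, zero_add, traceAt_smul, Pi.smul_apply, inner2_smul_smul]
  congr 1
  funext t
  ring

theorem DPhi_snd (hg : IsMetricOn g U) (hh : IsSmoothSymm h) (hw : IsSmoothSymm w) (hx : x ∈ U)
    (i : Fin 3) : (DPhi g 0 h w x).2 i = divergence g w x i := by
  have hG := differentiableAt_ginv_add_smul hg hh hx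
  have hC := differentiableAt_christoffel_add_smul hg hh hx
  have hd : DifferentiableAt ℝ (fun t : ℝ => divergence (g + t • h) w x i) 0 := by
    unfold divergence covDeriv
    fun_prop
  have hderiv := (hasDerivAt_id_mul hd).deriv
  simp only [zero_smul, add_zero] at hderiv
  simpa only [DPhi, Phi, zero_add, divergence_smul _ hw] using hderiv

end FirstVariation

/-! ### The formal adjoint as a differential operator -/

section Adjoint

/-- The divergence `∇_i T^{ijl}`. -/
def tensorDiv (g : Tensor2) (T : Fin 3 → Fin 3 → Fin 3 → E3 → ℝ) (x : E3) (j l : Fin 3) : ℝ :=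
  ∑ i, (pd i (T i j l) x + ∑ n, (christoffel g i i n x * T n j l x
    + christoffel g j i n x * T i n l x + christoffel g l i n x * T i j n x))

/-- The Hessian `∇_a ∇_b f`. -/
def hess (g : Tensor2) (f : E3 → ℝ) (x : E3) (a b : Fin 3) : ℝ :=
  pd a (pd b f) x - ∑ k, christoffel g k a b x * pd k f x

/-- The covariant derivative `∇_i X^l` of a vector field. -/
def covVec (g : Tensor2) (X : E3 → Fin 3 → ℝ) (x : E3) (i l : Fin 3) : ℝ :=
  pd i (fun y => X y l) x + ∑ n, christoffel g l i n x * X x n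

/-- The tensor `∇^j X^l`; minus its symmetrization is the part of `DΦ*(f, X)` paired with the
variation of `π` at `π = 0`. -/
def covUp (g : Tensor2) (X : E3 → Fin 3 → ℝ) (x : E3) (j l : Fin 3) : ℝ :=
  ∑ i, ginv g x i j * covVec g X x i l

/-- The tensor `∇^j ∇^l f - (Δ f) g^{jl} - f R^{jl}`, the part of `DΦ*(f, X)` paired with the
variation of the metric at `π = 0`. -/
def staticUp (g : Tensor2) (f : E3 → ℝ) (x : E3) (j l : Fin 3) : ℝ :=
  ∑ a, ∑ b, ginv g x j a * ginv g x l b * (hess g f x a b - f x * ricci g x a b)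
    - ginv g x j l * ∑ a, ∑ b, ginv g x a b * hess g f x a b

/-- The vector `g^{ij} δΓ^k_{ij} - g^{ik} δΓ^l_{il}`, whose divergence is `g^{ij} δR_{ij}`. -/
def varVec (g h : Tensor2) (k : Fin 3) (x : E3) : ℝ :=
  ∑ i, ∑ j, ginv g x i j * varChristoffel g h k i j x
    - ∑ i, ∑ l, ginv g x i k * varChristoffel g h l i l x

/-- The tensor `g^{ij} ∇^l f - ∇^i f g^{jl}`, whose divergence is `∇^j ∇^l f - (Δ f) g^{jl}`. -/
def gradTensor (g : Tensor2) (f : E3 → ℝ) (i j l : Fin 3) (x : E3) : ℝ :=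
  ∑ k, pd k f x * (ginv g x i j * ginv g x k l - ginv g x i k * ginv g x j l)

/-- The tensor `g^{ij} X^l`, whose divergence is `∇^j X^l`. -/
def vecTensor (g : Tensor2) (X : E3 → Fin 3 → ℝ) (i j l : Fin 3) (x : E3) : ℝ :=
  ginv g x i j * X x l

section Support

variable {g h : Tensor2} {x : E3}

theorem apply_eq_zero_of_notMem_tsupport (hx : x ∉ tsupport h) (i j : Fin 3) : h x i j = 0 := by
  rw [image_eq_zero_of_notMem_tsupport hx]; rfl

theorem covDeriv_eq_zero_of_notMem_tsupport (hx : x ∉ tsupport h) (i j k : Fin 3) :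
    covDeriv g h x i j k = 0 := by
  have hpd := pd_eq_zero_of_eqOn_compl (isClosed_tsupport h)
    (fun y hy => apply_eq_zero_of_notMem_tsupport hy j k) hx i
  simp [covDeriv, apply_eq_zero_of_notMem_tsupport hx, hpd]

theorem varChristoffel_eq_zero_of_notMem_tsupport (hx : x ∉ tsupport h) (k i j : Fin 3) :
    varChristoffel g h k i j x = 0 := by
  simp [varChristoffel, covDeriv_eq_zero_of_notMem_tsupport hx]

theorem varVec_eq_zero_of_notMem_tsupport (hx : x ∉ tsupport h) (k : Fin 3) :
    varVec g h k x = 0 := by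
  simp [varVec, varChristoffel_eq_zero_of_notMem_tsupport hx]

theorem varRicci_eq_zero_of_notMem_tsupport (hx : x ∉ tsupport h) (i j : Fin 3) :
    varRicci g h x i j = 0 := by
  have hpd : ∀ n k i j, pd n (varChristoffel g h k i j) x = 0 := fun n k i j =>
    pd_eq_zero_of_eqOn_compl (isClosed_tsupport h)
      (fun y hy => varChristoffel_eq_zero_of_notMem_tsupport hy k i j) hx n
  simp [varRicci, varChristoffel_eq_zero_of_notMem_tsupport hx, hpd]

theorem divergence_eq_zero_of_notMem_tsupport (hx : x ∉ tsupport h) (i : Fin 3) :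
    divergence g h x i = 0 := by
  simp [divergence, covDeriv_eq_zero_of_notMem_tsupport hx]

end Support

variable {g h w : Tensor2} {U : Set E3} {x : E3} {f : E3 → ℝ} {X : E3 → Fin 3 → ℝ}

section Smoothness

theorem contDiffOn_hess (hg : IsMetricOn g U) (hf : ContDiffOn ℝ ∞ f U) (a b : Fin 3) :
    ContDiffOn ℝ ∞ (fun y => hess g f y a b) U := by
  have hp := contDiffOn_pd hg.isOpen hf
  exact (contDiffOn_pd hg.isOpen (hp b) a).sub
    (ContDiffOn.sum fun k _ => (hg.contDiffOn_christoffel k a b).mul (hp k))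

theorem contDiffOn_covVec (hg : IsMetricOn g U) (hX : ∀ i, ContDiffOn ℝ ∞ (fun y => X y i) U)
    (i l : Fin 3) : ContDiffOn ℝ ∞ (fun y => covVec g X y i l) U :=
  (contDiffOn_pd hg.isOpen (hX l) i).add
    (ContDiffOn.sum fun n _ => (hg.contDiffOn_christoffel l i n).mul (hX n))

theorem contDiffOn_covUp (hg : IsMetricOn g U) (hX : ∀ i, ContDiffOn ℝ ∞ (fun y => X y i) U)
    (j l : Fin 3) : ContDiffOn ℝ ∞ (fun y => covUp g X y j l) U :=
  ContDiffOn.sum fun i _ => (hg.contDiffOn_ginv i j).mul (contDiffOn_covVec hg hX i l)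

theorem contDiffOn_staticUp (hg : IsMetricOn g U) (hf : ContDiffOn ℝ ∞ f U) (j l : Fin 3) :
    ContDiffOn ℝ ∞ (fun y => staticUp g f y j l) U := by
  have hG := hg.contDiffOn_ginv
  have hH := contDiffOn_hess hg hf
  exact (ContDiffOn.sum fun a _ => ContDiffOn.sum fun b _ => ((hG j a).mul (hG l b)).mul
      ((hH a b).sub (hf.mul (hg.contDiffOn_ricci a b)))).sub
    ((hG j l).mul (ContDiffOn.sum fun a _ => ContDiffOn.sum fun b _ => (hG a b).mul (hH a b)))

theorem contDiffOn_covDeriv (hg : IsMetricOn g U) (hh : IsSmoothSymm h) (i j k : Fin 3) :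
    ContDiffOn ℝ ∞ (fun y => covDeriv g h y i j k) U := by
  have hΓ := hg.contDiffOn_christoffel
  have hs := fun i j => (hh.smooth i j).contDiffOn (s := U)
  exact (contDiffOn_pd hg.isOpen (hs j k) i).sub (ContDiffOn.sum fun s _ =>
    ((hΓ s i j).mul (hs s k)).add ((hΓ s i k).mul (hs j s)))

theorem contDiffOn_varChristoffel (hg : IsMetricOn g U) (hh : IsSmoothSymm h) (k i j : Fin 3) :
    ContDiffOn ℝ ∞ (varChristoffel g h k i j) U := by
  have hd := contDiffOn_covDeriv hg hh
  exact contDiffOn_const.mul (ContDiffOn.sum fun l _ =>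
    (hg.contDiffOn_ginv k l).mul (((hd i j l).add (hd j i l)).sub (hd l i j)))

theorem contDiffOn_varVec (hg : IsMetricOn g U) (hh : IsSmoothSymm h) (k : Fin 3) :
    ContDiffOn ℝ ∞ (varVec g h k) U := by
  have hv := contDiffOn_varChristoffel hg hh
  have hG := hg.contDiffOn_ginv
  exact (ContDiffOn.sum fun i _ => ContDiffOn.sum fun j _ => (hG i j).mul (hv k i j)).sub
    (ContDiffOn.sum fun i _ => ContDiffOn.sum fun l _ => (hG i k).mul (hv l i l))

theorem contDiffOn_gradTensor (hg : IsMetricOn g U) (hf : ContDiffOn ℝ ∞ f U) (i j l : Fin 3) :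
    ContDiffOn ℝ ∞ (gradTensor g f i j l) U := by
  have hG := hg.contDiffOn_ginv
  exact ContDiffOn.sum fun k _ => (contDiffOn_pd hg.isOpen hf k).mul
    (((hG i j).mul (hG k l)).sub ((hG i k).mul (hG j l)))

theorem contDiffOn_vecTensor (hg : IsMetricOn g U) (hX : ∀ i, ContDiffOn ℝ ∞ (fun y => X y i) U)
    (i j l : Fin 3) : ContDiffOn ℝ ∞ (vecTensor g X i j l) U :=
  (hg.contDiffOn_ginv i j).mul (hX l)

end Smoothness

section IndexIdentities

variable {G : Fin 3 → Fin 3 → ℝ} {Γ C N dG : Fin 3 → Fin 3 → Fin 3 → ℝ}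

theorem contracted_varRicci_eq (dC : Fin 3 → Fin 3 → Fin 3 → Fin 3 → ℝ)
    (hG : ∀ i j, G i j = G j i) (hΓ : ∀ k i j, Γ k i j = Γ k j i)
    (hC : ∀ k i j, C k i j = C k j i)
    (hdG : ∀ k i j, dG k i j = -∑ l, (G i l * Γ j k l + Γ i k l * G l j)) :
    ∑ i, ∑ j, G i j * ∑ k, (dC k k i j - dC j k i k + ∑ l, ((C k k l * Γ l i j + Γ k k l * C l i j)
        - (C k j l * Γ l i k + Γ k j l * C l i k))) =
      ∑ k, ((∑ l, Γ l k l) * (∑ i, ∑ j, G i j * C k i j - ∑ i, ∑ l, G i k * C l i l)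
        + (∑ i, ∑ j, (dG k i j * C k i j + G i j * dC k k i j)
        - ∑ i, ∑ l, (dG k i k * C l i l + G i k * dC k l i l))) := by
  have a0 := hG 1 0; have a1 := hG 2 0; have a2 := hG 2 1
  have b0 := fun k => hΓ k 1 0; have b1 := fun k => hΓ k 2 0; have b2 := fun k => hΓ k 2 1
  have c0 := fun k => hC k 1 0; have c1 := fun k => hC k 2 0; have c2 := fun k => hC k 2 1
  simp only [hdG, Fin.sum_univ_three, a0, a1, a2, b0, b1, b2, c0, c1, c2]
  ring

theorem contracted_varChristoffel_eq (u : Fin 3 → ℝ)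
    (hG : ∀ i j, G i j = G j i) (hN : ∀ k i j, N k i j = N k j i)
    (hC : ∀ k i j, C k i j = 1 / 2 * ∑ l, G k l * (N i j l + N j i l - N l i j)) :
    ∑ k, u k * (∑ i, ∑ j, G i j * C k i j - ∑ i, ∑ l, G i k * C l i l) =
      ∑ i, ∑ j, ∑ l, (∑ k, u k * (G i j * G k l - G i k * G j l)) * N i j l := by
  have a0 := hG 1 0; have a1 := hG 2 0; have a2 := hG 2 1
  have b0 := fun k => hN k 1 0; have b1 := fun k => hN k 2 0; have b2 := fun k => hN k 2 1
  simp only [hC, Fin.sum_univ_three, a0, a1, a2, b0, b1, b2]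
  ring

theorem div_pairing_eq (T : Fin 3 → Fin 3 → Fin 3 → ℝ) (dT : Fin 3 → Fin 3 → Fin 3 → Fin 3 → ℝ)
    (h : Fin 3 → Fin 3 → ℝ) (dh : Fin 3 → Fin 3 → Fin 3 → ℝ)
    (hΓ : ∀ k i j, Γ k i j = Γ k j i) :
    ∑ i, ∑ j, ∑ l, T i j l * (dh i j l - ∑ s, (Γ s i j * h s l + Γ s i l * h j s))
      + ∑ j, ∑ l, (∑ i, (dT i i j l
        + ∑ n, (Γ i i n * T n j l + Γ j i n * T i n l + Γ l i n * T i j n))) * h j l =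
    ∑ i, ((∑ l, Γ l i l) * ∑ j, ∑ l, T i j l * h j l
      + ∑ j, ∑ l, (dT i i j l * h j l + T i j l * dh i j l)) := by
  have b0 := fun k => hΓ k 1 0; have b1 := fun k => hΓ k 2 0; have b2 := fun k => hΓ k 2 1
  simp only [Fin.sum_univ_three, b0, b1, b2]
  ring

theorem tensorDiv_gradient_eq (u : Fin 3 → ℝ) (du : Fin 3 → Fin 3 → ℝ)
    (hG : ∀ i j, G i j = G j i) (hΓ : ∀ k i j, Γ k i j = Γ k j i)
    (hdG : ∀ k i j, dG k i j = -∑ l, (G i l * Γ j k l + Γ i k l * G l j)) (j l : Fin 3) :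
    ∑ i, (∑ k, (du i k * (G i j * G k l - G i k * G j l)
        + u k * ((dG i i j * G k l + G i j * dG i k l) - (dG i i k * G j l + G i k * dG i j l)))
      + ∑ n, (Γ i i n * (∑ k, u k * (G n j * G k l - G n k * G j l))
        + Γ j i n * (∑ k, u k * (G i n * G k l - G i k * G n l))
        + Γ l i n * ∑ k, u k * (G i j * G k n - G i k * G j n))) =
      ∑ a, ∑ b, G j a * G l b * (du a b - ∑ k, Γ k a b * u k)
        - G j l * ∑ a, ∑ b, G a b * (du a b - ∑ k, Γ k a b * u k) := by
  have a0 := hG 1 0; have a1 := hG 2 0; have a2 := hG 2 1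
  have b0 := fun k => hΓ k 1 0; have b1 := fun k => hΓ k 2 0; have b2 := fun k => hΓ k 2 1
  have j0 := hG 0 j; have j1 := hG 1 j; have j2 := hG 2 j
  have l0 := hG 0 l; have l1 := hG 1 l; have l2 := hG 2 l
  simp only [hdG, Fin.sum_univ_three, a0, a1, a2, b0, b1, b2, j0, j1, j2, l0, l1, l2]
  ring

theorem tensorDiv_vector_eq (X : Fin 3 → ℝ) (dX : Fin 3 → Fin 3 → ℝ)
    (hG : ∀ i j, G i j = G j i) (hΓ : ∀ k i j, Γ k i j = Γ k j i)
    (hdG : ∀ k i j, dG k i j = -∑ l, (G i l * Γ j k l + Γ i k l * G l j)) (j l : Fin 3) :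
    ∑ i, ((dG i i j * X l + G i j * dX i l)
      + ∑ n, (Γ i i n * (G n j * X l) + Γ j i n * (G i n * X l) + Γ l i n * (G i j * X n))) =
      ∑ i, G i j * (dX i l + ∑ n, Γ l i n * X n) := by
  have a0 := hG 1 0; have a1 := hG 2 0; have a2 := hG 2 1
  have b0 := fun k => hΓ k 1 0; have b1 := fun k => hΓ k 2 0; have b2 := fun k => hΓ k 2 1
  have j0 := hG 0 j; have j1 := hG 1 j; have j2 := hG 2 j
  simp only [hdG, Fin.sum_univ_three, a0, a1, a2, b0, b1, b2, j0, j1, j2]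
  ring

theorem sum_mul_varInverse_mul (hG : ∀ i j, G i j = G j i)
    (A : Matrix (Fin 3) (Fin 3) ℝ) (R : Fin 3 → Fin 3 → ℝ) :
    ∑ i, ∑ j, (-∑ a, ∑ b, G i a * A a b * G b j) * R i j =
      -∑ j, ∑ l, (∑ a, ∑ b, G j a * G l b * R a b) * A j l := by
  have a0 := hG 1 0; have a1 := hG 2 0; have a2 := hG 2 1
  simp only [Fin.sum_univ_three, a0, a1, a2]
  ring

end IndexIdentities

section Divergences

theorem covDeriv_symm (hh : IsSmoothSymm h) (g : Tensor2) (x : E3) (i j k : Fin 3) :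
    covDeriv g h x i j k = covDeriv g h x i k j := by
  simp only [covDeriv, hh.symm _ j k]
  congr 1
  refine Finset.sum_congr rfl fun s _ => ?_
  rw [hh.symm x s k, hh.symm x j s]
  ring

theorem varChristoffel_symm (hh : IsSmoothSymm h) (g : Tensor2) (x : E3) (k i j : Fin 3) :
    varChristoffel g h k i j x = varChristoffel g h k j i x := by
  simp only [varChristoffel]
  congr 1
  refine Finset.sum_congr rfl fun l _ => ?_
  rw [covDeriv_symm hh g x l i j]
  ring

theorem sum_ginv_mul_varRicci (hg : IsMetricOn g U) (hh : IsSmoothSymm h) (hx : x ∈ U) :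
    volDensity g x * ∑ i, ∑ j, ginv g x i j * varRicci g h x i j =
      ∑ k, pd k (fun y => volDensity g y * varVec g h k y) x := by
  have hG := hg.hasGrad_ginv hx
  have hC := fun k i j => hasGrad_of_contDiffOn hg.isOpen (contDiffOn_varChristoffel hg hh k i j) hx
  have hP := fun k => ((hg.hasGrad_volDensity hx).mul
    ((HasGrad.sum Finset.univ fun i _ => HasGrad.sum Finset.univ fun j _ =>
      (hG i j).mul (hC k i j)).sub (HasGrad.sum Finset.univ fun i _ =>
        HasGrad.sum Finset.univ fun l _ => (hG i k).mul (hC l i l)))).pd_eq k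
  refine .trans ?_ (Finset.sum_congr rfl fun k _ => hP k).symm
  simp only [varRicci]
  rw [contracted_varRicci_eq (fun n k i j => pd n (varChristoffel g h k i j) x)
    (hg.ginv_symm hx) (hg.christoffel_symm hx) (varChristoffel_symm hh g x) fun _ _ _ => rfl,
    Finset.mul_sum]
  refine Finset.sum_congr rfl fun k _ => ?_
  ring

theorem sum_pd_mul_varVec (hg : IsMetricOn g U) (hh : IsSmoothSymm h) (hx : x ∈ U) (f : E3 → ℝ) :
    ∑ k, pd k f x * varVec g h k x =
      ∑ i, ∑ j, ∑ l, gradTensor g f i j l x * covDeriv g h x i j l :=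
  contracted_varChristoffel_eq (fun k => pd k f x) (hg.ginv_symm hx) (covDeriv_symm hh g x)
    fun _ _ _ => rfl

theorem tensor_pairing_eq_div (hg : IsMetricOn g U) (hh : IsSmoothSymm h) (hx : x ∈ U)
    {T : Fin 3 → Fin 3 → Fin 3 → E3 → ℝ} (hT : ∀ i j l, ContDiffOn ℝ ∞ (T i j l) U) :
    volDensity g x * (∑ i, ∑ j, ∑ l, T i j l x * covDeriv g h x i j l
        + ∑ j, ∑ l, tensorDiv g T x j l * h x j l) =
      ∑ i, pd i (fun y => volDensity g y * ∑ j, ∑ l, T i j l y * h y j l) x := by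
  have hP := fun i => ((hg.hasGrad_volDensity hx).mul (HasGrad.sum Finset.univ fun j _ =>
    HasGrad.sum Finset.univ fun l _ =>
      (hasGrad_of_contDiffOn hg.isOpen (hT i j l) hx).mul (hh.hasGrad x j l))).pd_eq i
  refine .trans ?_ (Finset.sum_congr rfl fun i _ => hP i).symm
  simp only [covDeriv, tensorDiv]
  rw [div_pairing_eq (fun i j l => T i j l x) (fun n i j l => pd n (T i j l) x) (h x)
    (fun n j l => pd n (fun y => h y j l) x) (hg.christoffel_symm hx), Finset.mul_sum]
  refine Finset.sum_congr rfl fun k _ => ?_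
  ring

theorem tensorDiv_gradTensor (hg : IsMetricOn g U) (hx : x ∈ U) (hf : ContDiffOn ℝ ∞ f U)
    (j l : Fin 3) :
    tensorDiv g (gradTensor g f) x j l =
      ∑ a, ∑ b, ginv g x j a * ginv g x l b * hess g f x a b
        - ginv g x j l * ∑ a, ∑ b, ginv g x a b * hess g f x a b := by
  have hG := hg.hasGrad_ginv hx
  have hu := fun k => hasGrad_of_contDiffOn hg.isOpen (contDiffOn_pd hg.isOpen hf k) hx
  have hT : ∀ i, HasGrad (gradTensor g f i j l) _ x := fun i =>
    HasGrad.sum Finset.univ fun k _ => (hu k).mul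
      (((hG i j).mul (hG k l)).sub ((hG i k).mul (hG j l)))
  simp only [tensorDiv, (hT _).pd_eq]
  exact tensorDiv_gradient_eq (fun k => pd k f x) (fun a b => pd a (pd b f) x)
    (hg.ginv_symm hx) (hg.christoffel_symm hx) (fun _ _ _ => rfl) j l

theorem tensorDiv_vecTensor (hg : IsMetricOn g U) (hx : x ∈ U)
    (hX : ∀ i, ContDiffOn ℝ ∞ (fun y => X y i) U) (j l : Fin 3) :
    tensorDiv g (vecTensor g X) x j l = covUp g X x j l := by
  have hT : ∀ i, HasGrad (vecTensor g X i j l) _ x := fun i =>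
    (hg.hasGrad_ginv hx i j).mul (hasGrad_of_contDiffOn hg.isOpen (hX l) hx)
  simp only [tensorDiv, (hT _).pd_eq]
  exact tensorDiv_vector_eq (X x) (fun a b => pd a (fun y => X y b) x)
    (hg.ginv_symm hx) (hg.christoffel_symm hx) (fun _ _ _ => rfl) j l

theorem inner1_divergence (hg : IsMetricOn g U) (hx : x ∈ U) (w : Tensor2) (V : Fin 3 → ℝ) :
    inner1 g x V (divergence g w x) =
      ∑ i, ∑ j, ∑ l, ginv g x i j * V l * covDeriv g w x i j l := by
  calc inner1 g x V (divergence g w x)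
      = ∑ i, ∑ l, (∑ k, g x i k * ginv g x k l) *
          (V i * ∑ a, ∑ b, ginv g x a b * covDeriv g w x a b l) := by
        simp only [inner1, divergence, Fin.sum_univ_three]
        ring
    _ = ∑ l, V l * ∑ a, ∑ b, ginv g x a b * covDeriv g w x a b l := by
        simp only [hg.sum_mul_ginv hx, ite_mul, one_mul, zero_mul, Finset.sum_ite_eq,
          Finset.mem_univ, if_true]
    _ = _ := by
        simp only [Fin.sum_univ_three]
        ring

theorem sum_tensorDiv_gradTensor_mul (hg : IsMetricOn g U) (hx : x ∈ U) (hf : ContDiffOn ℝ ∞ f U)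
    (A : Matrix (Fin 3) (Fin 3) ℝ) :
    ∑ j, ∑ l, tensorDiv g (gradTensor g f) x j l * A j l =
      ∑ j, ∑ l, staticUp g f x j l * A j l
        + f x * ∑ j, ∑ l, (∑ a, ∑ b, ginv g x j a * ginv g x l b * ricci g x a b) * A j l := by
  have hsplit : ∀ j l, tensorDiv g (gradTensor g f) x j l = staticUp g f x j l
      + f x * ∑ a, ∑ b, ginv g x j a * ginv g x l b * ricci g x a b := by
    intro j l
    simp only [tensorDiv_gradTensor hg hx hf, staticUp, mul_sub, Finset.sum_sub_distrib,
      mul_left_comm _ (f x), ← Finset.mul_sum]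
    ring
  simp only [hsplit, add_mul, Finset.sum_add_distrib, mul_assoc, ← Finset.mul_sum]

end Divergences

end Adjoint

/-! ### Integration by parts -/

section Weak

/-- The integrand `(f DΦ(h, w)₁ + ⟨X, DΦ(h, w)₂⟩) √(det g)` at `π = 0`. -/
def pairing (g h w : Tensor2) (f : E3 → ℝ) (X : E3 → Fin 3 → ℝ) (x : E3) : ℝ :=
  (f x * (DPhi g 0 h w x).1 + inner1 g x (X x) (DPhi g 0 h w x).2) * volDensity g x

/-- The flux whose coordinate divergence is `pairing - adjointPairing`. -/
def flux (g h w : Tensor2) (f : E3 → ℝ) (X : E3 → Fin 3 → ℝ) (k : Fin 3) (y : E3) : ℝ :=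
  f y * (volDensity g y * varVec g h k y)
    - volDensity g y * ∑ j, ∑ l, gradTensor g f k j l y * h y j l
    + volDensity g y * ∑ j, ∑ l, vecTensor g X k j l y * w y j l

/-- The integrand `⟨DΦ*(f, X), (h, w)⟩ √(det g)` at `π = 0`. -/
def adjointPairing (g h w : Tensor2) (f : E3 → ℝ) (X : E3 → Fin 3 → ℝ) (y : E3) : ℝ :=
  volDensity g y * (∑ j, ∑ l, staticUp g f y j l * h y j l - ∑ j, ∑ l, covUp g X y j l * w y j l)

variable {g h w : Tensor2} {H U : Set E3} {x : E3} {f : E3 → ℝ} {X : E3 → Fin 3 → ℝ}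

theorem contDiffOn_volDensity_mul_sum (hg : IsMetricOn g U) (hh : IsSmoothSymm h)
    {T : Fin 3 → Fin 3 → E3 → ℝ} (hT : ∀ j l, ContDiffOn ℝ ∞ (T j l) U) :
    ContDiffOn ℝ ∞ (fun y => volDensity g y * ∑ j, ∑ l, T j l y * h y j l) U :=
  hg.contDiffOn_volDensity.mul (ContDiffOn.sum fun j _ =>
    ContDiffOn.sum fun l _ => (hT j l).mul (hh.smooth j l).contDiffOn)

theorem contDiffOn_flux (hg : IsMetricOn g U) (hh : IsSmoothSymm h) (hw : IsSmoothSymm w)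
    (hf : ContDiffOn ℝ ∞ f U) (hX : ∀ i, ContDiffOn ℝ ∞ (fun y => X y i) U) (k : Fin 3) :
    ContDiffOn ℝ ∞ (flux g h w f X k) U :=
  ((hf.mul (hg.contDiffOn_volDensity.mul (contDiffOn_varVec hg hh k))).sub
    (contDiffOn_volDensity_mul_sum hg hh fun j l => contDiffOn_gradTensor hg hf k j l)).add
    (contDiffOn_volDensity_mul_sum hg hw fun j l => contDiffOn_vecTensor hg hX k j l)

theorem contDiffOn_adjointPairing (hg : IsMetricOn g U) (hh : IsSmoothSymm h)
    (hw : IsSmoothSymm w) (hf : ContDiffOn ℝ ∞ f U) (hX : ∀ i, ContDiffOn ℝ ∞ (fun y => X y i) U) :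
    ContDiffOn ℝ ∞ (adjointPairing g h w f X) U :=
  ((contDiffOn_volDensity_mul_sum hg hh fun j l => contDiffOn_staticUp hg hf j l).sub
    (contDiffOn_volDensity_mul_sum hg hw fun j l => contDiffOn_covUp hg hX j l)).congr
    fun _ _ => mul_sub _ _ _

theorem sum_pd_flux (hg : IsMetricOn g U) (hh : IsSmoothSymm h) (hw : IsSmoothSymm w)
    (hx : x ∈ U) (hf : ContDiffOn ℝ ∞ f U) (hX : ∀ i, ContDiffOn ℝ ∞ (fun y => X y i) U) :
    ∑ k, pd k (flux g h w f X k) x =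
      ∑ k, pd k f x * (volDensity g x * varVec g h k x)
        + f x * ∑ k, pd k (fun y => volDensity g y * varVec g h k y) x
        - ∑ k, pd k (fun y => volDensity g y * ∑ j, ∑ l, gradTensor g f k j l y * h y j l) x
        + ∑ k, pd k (fun y => volDensity g y * ∑ j, ∑ l, vecTensor g X k j l y * w y j l) x := by
  have hP := fun k => (((hasGrad_of_contDiffOn hg.isOpen hf hx).mul
      (hasGrad_of_contDiffOn hg.isOpen
        (hg.contDiffOn_volDensity.mul (contDiffOn_varVec hg hh k)) hx)).sub
    (hasGrad_of_contDiffOn hg.isOpen (contDiffOn_volDensity_mul_sum hg hh fun j l =>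
      contDiffOn_gradTensor hg hf k j l) hx) |>.add
    (hasGrad_of_contDiffOn hg.isOpen (contDiffOn_volDensity_mul_sum hg hw fun j l =>
      contDiffOn_vecTensor hg hX k j l) hx)).pd_eq k
  refine (Finset.sum_congr rfl fun k _ => hP k).trans ?_
  simp only [Finset.sum_add_distrib, Finset.sum_sub_distrib, ← Finset.mul_sum]

theorem pairing_eq_sum_pd_flux_add (hg : IsMetricOn g U) (hh : IsSmoothSymm h)
    (hw : IsSmoothSymm w) (hx : x ∈ U) (hf : ContDiffOn ℝ ∞ f U)
    (hX : ∀ i, ContDiffOn ℝ ∞ (fun y => X y i) U) :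
    pairing g h w f X x = ∑ k, pd k (flux g h w f X k) x + adjointPairing g h w f X x := by
  have hscalar : (DPhi g 0 h w x).1 =
      ∑ i, ∑ j, ginv g x i j * varRicci g h x i j
        - ∑ j, ∑ l, (∑ a, ∑ b, ginv g x j a * ginv g x l b * ricci g x a b) * h x j l := by
    rw [DPhi_fst hg hh hx]
    simp only [Finset.sum_add_distrib, sum_mul_varInverse_mul (hg.ginv_symm hx)]
    ring
  have hdiv : inner1 g x (X x) (DPhi g 0 h w x).2 =
      ∑ i, ∑ j, ∑ l, vecTensor g X i j l x * covDeriv g w x i j l := by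
    rw [funext (DPhi_snd hg hh hw hx), inner1_divergence hg hx]
    rfl
  have hgrad : ∑ k, pd k f x * (volDensity g x * varVec g h k x) =
      volDensity g x * ∑ i, ∑ j, ∑ l, gradTensor g f i j l x * covDeriv g h x i j l := by
    rw [← sum_pd_mul_varVec hg hh hx f, Finset.mul_sum]
    exact Finset.sum_congr rfl fun k _ => mul_left_comm _ _ _
  rw [sum_pd_flux hg hh hw hx hf hX, ← tensor_pairing_eq_div hg hh hx (contDiffOn_gradTensor hg hf),
    ← tensor_pairing_eq_div hg hw hx (contDiffOn_vecTensor hg hX),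
    ← sum_ginv_mul_varRicci hg hh hx, hgrad, sum_tensorDiv_gradTensor_mul hg hx hf, pairing,
    adjointPairing, hscalar, hdiv]
  simp only [tensorDiv_vecTensor hg hx hX]
  ring

theorem pairing_eq_zero_of_notMem_tsupport (hg : IsMetricOn g U) (hh : IsSmoothSymm h)
    (hw : IsSmoothSymm w) (hx : x ∈ U) (hxh : x ∉ tsupport h) (hxw : x ∉ tsupport w) :
    pairing g h w f X x = 0 := by
  simp [pairing, DPhi_fst hg hh hx, inner1, DPhi_snd hg hh hw hx,
    divergence_eq_zero_of_notMem_tsupport hxw, apply_eq_zero_of_notMem_tsupport hxh,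
    varRicci_eq_zero_of_notMem_tsupport hxh]

theorem flux_eq_zero_of_notMem_tsupport (g : Tensor2) (hxh : x ∉ tsupport h)
    (hxw : x ∉ tsupport w) (k : Fin 3) : flux g h w f X k x = 0 := by
  simp [flux, varVec_eq_zero_of_notMem_tsupport hxh, apply_eq_zero_of_notMem_tsupport hxh,
    apply_eq_zero_of_notMem_tsupport hxw]

theorem adjointPairing_eq_zero_of_notMem_tsupport (g : Tensor2) (hxh : x ∉ tsupport h)
    (hxw : x ∉ tsupport w) : adjointPairing g h w f X x = 0 := by
  simp [adjointPairing, apply_eq_zero_of_notMem_tsupport hxh, apply_eq_zero_of_notMem_tsupport hxw]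

theorem setIntegral_pairing (hg : IsMetricOn g U) (hHm : MeasurableSet H) (hHU : H ⊆ U)
    (hf : ContDiffOn ℝ ∞ f (interior H))
    (hX : ∀ i, ContDiffOn ℝ ∞ (fun y => X y i) (interior H)) (hh : IsTest H h) (hw : IsTest H w) :
    ∫ x in H, pairing g h w f X x = ∫ x, adjointPairing g h w f X x := by
  have hgi := hg.mono isOpen_interior (interior_subset.trans hHU)
  have hhs := hh.isSmoothSymm
  have hws := hw.isSmoothSymm
  set K := tsupport h ∪ tsupport w
  have hK : IsCompact K := hh.compact.isCompact.union hw.compact.isCompact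
  have hKH : K ⊆ interior H := Set.union_subset hh.support hw.support
  have hnotMem : ∀ y ∉ K, y ∉ tsupport h ∧ y ∉ tsupport w := fun y hy =>
    ⟨fun hy' => hy (.inl hy'), fun hy' => hy (.inr hy')⟩
  have hP := contDiffOn_flux hgi hhs hws hf hX
  have hP0 : ∀ k, ∀ y ∉ K, flux g h w f X k y = 0 := fun k y hy =>
    flux_eq_zero_of_notMem_tsupport g (hnotMem y hy).1 (hnotMem y hy).2 k
  have hdP0 : ∀ k, ∀ y ∉ K, pd k (flux g h w f X k) y = 0 := fun k y hy =>
    pd_eq_zero_of_eqOn_compl hK.isClosed (hP0 k) hy k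
  have hQ0 : ∀ y ∉ K, adjointPairing g h w f X y = 0 := fun y hy =>
    adjointPairing_eq_zero_of_notMem_tsupport g (hnotMem y hy).1 (hnotMem y hy).2
  have hcongr : ∀ x ∈ H, pairing g h w f X x =
      ∑ k, pd k (flux g h w f X k) x + adjointPairing g h w f X x := by
    intro x hx
    by_cases hxK : x ∈ K
    · exact pairing_eq_sum_pd_flux_add hgi hhs hws (hKH hxK) hf hX
    · rw [pairing_eq_zero_of_notMem_tsupport hg hhs hws (hHU hx) (hnotMem x hxK).1
        (hnotMem x hxK).2, hQ0 x hxK, Finset.sum_eq_zero fun k _ => hdP0 k x hxK, add_zero]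
  have hiP : ∀ k ∈ Finset.univ, Integrable (pd k (flux g h w f X k)) := fun k _ =>
    integrable_of_eqOn_compl isOpen_interior (contDiffOn_pd isOpen_interior (hP k) k) hK hKH
      (hdP0 k)
  have hiQ := integrable_of_eqOn_compl isOpen_interior
    (contDiffOn_adjointPairing hgi hhs hws hf hX) hK hKH hQ0
  rw [setIntegral_congr_fun hHm hcongr, setIntegral_eq_integral_of_forall_compl_eq_zero,
    integral_add (integrable_finsetSum _ hiP) hiQ, integral_finsetSum _ hiP,
    Finset.sum_eq_zero fun k _ => integral_pd_eq_zero isOpen_interior (hP k) hK hKH (hP0 k) k,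
    zero_add]
  intro x hx
  have hxK : x ∉ K := fun hxK => hx (interior_subset (hKH hxK))
  rw [hQ0 x hxK, Finset.sum_eq_zero fun k _ => hdP0 k x hxK, zero_add]

/-- The test tensor `φ (e_a ⊗ e_b + e_b ⊗ e_a)`. -/
def elemTensor (φ : E3 → ℝ) (a b : Fin 3) : Tensor2 := fun x =>
  φ x • (Matrix.single a b 1 + Matrix.single b a 1)

theorem elemTensor_apply (φ : E3 → ℝ) (a b : Fin 3) (x : E3) (i j : Fin 3) :
    elemTensor φ a b x i j =
      φ x * ((if a = i ∧ b = j then 1 else 0) + if b = i ∧ a = j then 1 else 0) := by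
  simp only [elemTensor, Matrix.smul_apply, Matrix.add_apply, Matrix.single_apply, smul_eq_mul]

theorem isTest_elemTensor {φ : E3 → ℝ} (hφ : ContDiff ℝ ∞ φ) (hc : HasCompactSupport φ)
    (hs : tsupport φ ⊆ interior H) (a b : Fin 3) : IsTest H (elemTensor φ a b) := by
  have hsub : tsupport (elemTensor φ a b) ⊆ tsupport φ :=
    closure_mono (Function.support_smul_subset_left φ _)
  exact
  { symm := fun x i j => by simp only [elemTensor_apply, and_comm, add_comm]
    smooth := fun i j => by simpa only [elemTensor_apply] using hφ.mul contDiff_const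
    compact := hc.of_isClosed_subset (isClosed_tsupport _) hsub
    support := hsub.trans hs }

theorem isTest_zero : IsTest H 0 where
  symm := fun _ _ _ => rfl
  smooth := fun _ _ => contDiff_const
  compact := HasCompactSupport.zero
  support := by simp [tsupport]

theorem sum_mul_elemTensor (S : Fin 3 → Fin 3 → ℝ) (φ : E3 → ℝ) (a b : Fin 3) (x : E3) :
    ∑ j, ∑ l, S j l * elemTensor φ a b x j l = φ x * (S a b + S b a) := by
  simp only [elemTensor_apply, Fin.sum_univ_three]
  fin_cases a <;> fin_cases b <;> simp <;> ring

theorem eqOn_zero_of_integral_eq_zero (hU : IsOpen U) {u : E3 → ℝ} (hu : ContDiffOn ℝ ∞ u U)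
    (h : ∀ φ : E3 → ℝ, ContDiff ℝ ∞ φ → HasCompactSupport φ → tsupport φ ⊆ U →
      ∫ x, φ x * u x = 0) : ∀ x ∈ U, u x = 0 := by
  have hae := hU.ae_eq_zero_of_integral_contDiff_smul_eq_zero (μ := (volume : Measure E3))
    (hu.continuousOn.locallyIntegrableOn hU.measurableSet) h
  have hae' : u =ᵐ[volume.restrict U] fun _ => (0 : ℝ) :=
    (ae_restrict_iff' hU.measurableSet).2 hae
  exact Measure.eqOn_open_of_ae_eq hae' hU hu.continuousOn continuousOn_const

theorem symm_part_eq_zero_of_integral_eq_zero (hg : IsMetricOn g U) {S : E3 → Fin 3 → Fin 3 → ℝ}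
    (hS : ∀ a b, ContDiffOn ℝ ∞ (fun x => S x a b) U)
    (h : ∀ k, IsTest U k → ∫ x, volDensity g x * ∑ j, ∑ l, S x j l * k x j l = 0)
    (hx : x ∈ U) (a b : Fin 3) : S x a b + S x b a = 0 := by
  have hzero := eqOn_zero_of_integral_eq_zero hg.isOpen
    (hg.contDiffOn_volDensity.mul ((hS a b).add (hS b a))) (fun φ hφ hc hs => ?_) x hx
  · exact (mul_eq_zero.1 hzero).resolve_left (hg.volDensity_pos hx).ne'
  · rw [← h _ (isTest_elemTensor hφ hc (hs.trans_eq hg.isOpen.interior_eq.symm) a b)]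
    simp only [sum_mul_elemTensor, mul_left_comm]

theorem sum_mul_eq_zero_of_antisymm {S T : Fin 3 → Fin 3 → ℝ} (hS : ∀ a b, S a b + S b a = 0)
    (hT : ∀ a b, T a b = T b a) : ∑ j, ∑ l, S j l * T j l = 0 := by
  have hswap : ∑ j, ∑ l, S j l * T j l = ∑ j, ∑ l, S l j * T j l := by
    rw [Finset.sum_comm]
    simp only [hT]
  have hadd : ∑ j, ∑ l, S j l * T j l + ∑ j, ∑ l, S l j * T j l = 0 := by
    simp only [← Finset.sum_add_distrib, ← add_mul, hS, zero_mul, Finset.sum_const_zero]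
  linarith

theorem IsTest.of_interior (hh : IsTest (interior H) h) : IsTest H h :=
  ⟨hh.symm, hh.smooth, hh.compact, hh.support.trans interior_subset⟩

theorem forall_setIntegral_pairing_eq_zero_iff (hg : IsMetricOn g U) (hHm : MeasurableSet H)
    (hHU : H ⊆ U) (hf : ContDiffOn ℝ ∞ f (interior H))
    (hX : ∀ i, ContDiffOn ℝ ∞ (fun y => X y i) (interior H)) :
    (∀ h w, IsTest H h → IsTest H w → ∫ x in H, pairing g h w f X x = 0) ↔
      ∀ x ∈ interior H, ∀ a b, staticUp g f x a b + staticUp g f x b a = 0 ∧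
        covUp g X x a b + covUp g X x b a = 0 := by
  have hgi := hg.mono isOpen_interior (interior_subset.trans hHU)
  constructor
  · intro hz x hx a b
    constructor
    · refine symm_part_eq_zero_of_integral_eq_zero hgi (contDiffOn_staticUp hgi hf)
        (fun k hk => ?_) hx a b
      rw [← hz k 0 hk.of_interior isTest_zero,
        setIntegral_pairing hg hHm hHU hf hX hk.of_interior isTest_zero]
      simp [adjointPairing]
    · refine symm_part_eq_zero_of_integral_eq_zero hgi (contDiffOn_covUp hgi hX)
        (fun k hk => ?_) hx a b
      rw [← neg_eq_zero, ← integral_neg, ← hz 0 k isTest_zero hk.of_interior,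
        setIntegral_pairing hg hHm hHU hf hX isTest_zero hk.of_interior]
      simp [adjointPairing]
  · intro hz h w hh hw
    have h0 : ∀ x, adjointPairing g h w f X x = 0 := by
      intro x
      by_cases hx : x ∈ interior H
      · rw [adjointPairing, sum_mul_eq_zero_of_antisymm (fun a b => (hz x hx a b).1) (hh.symm x),
          sum_mul_eq_zero_of_antisymm (fun a b => (hz x hx a b).2) (hw.symm x), sub_zero, mul_zero]
      · exact adjointPairing_eq_zero_of_notMem_tsupport g (fun h' => hx (hh.support h'))
          (fun h' => hx (hw.support h'))
    simp only [setIntegral_pairing hg hHm hHU hf hX hh hw, h0, integral_zero]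

end Weak

/-! ### Static potentials and Killing fields -/

section StaticKilling

/-- `f` is a static potential of the scalar-flat metric `g` on `U`: it solves the static vacuum
equation `∇∇f = f Ric`. -/
def IsStaticPotential (g : Tensor2) (f : E3 → ℝ) (U : Set E3) : Prop :=
  ∀ x ∈ U, ∀ a b, hess g f x a b = f x * ricci g x a b

/-- The Lie derivative `(L_X T)_{ij}` of a covariant 2-tensor field. -/
def lieDeriv (X : E3 → Fin 3 → ℝ) (T : Tensor2) (x : E3) (i j : Fin 3) : ℝ :=
  ∑ l, (X x l * pd l (fun y => T y i j) x
    + (pd i (fun y => X y l) x * T x l j + pd j (fun y => X y l) x * T x i l))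

/-- `X` is a Killing field of `g` on `U`: `L_X g = 0`. -/
def IsKilling (g : Tensor2) (X : E3 → Fin 3 → ℝ) (U : Set E3) : Prop :=
  ∀ x ∈ U, ∀ i j, lieDeriv X g x i j = 0

variable {g : Tensor2} {H U : Set E3} {x : E3} {f : E3 → ℝ} {X : E3 → Fin 3 → ℝ}

theorem hess_symm (hg : IsMetricOn g U) (hx : x ∈ U) (hf : ContDiffOn ℝ ∞ f U) (a b : Fin 3) :
    hess g f x a b = hess g f x b a := by
  simp only [hess, pd_comm hg.isOpen hf hx a b, hg.christoffel_symm hx _ a b]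

theorem transpose_inv_metric (hg : IsMetricOn g U) (hx : x ∈ U) :
    ((g x)⁻¹).transpose = (g x)⁻¹ := by
  rw [Matrix.transpose_nonsing_inv, hg.transpose_eq hx]

theorem staticUp_eq (hg : IsMetricOn g U) (hx : x ∈ U) :
    Matrix.of (staticUp g f x) =
      (g x)⁻¹ * Matrix.of (fun a b => hess g f x a b - f x * ricci g x a b) * (g x)⁻¹
        - (∑ a, ∑ b, ginv g x a b * hess g f x a b) • (g x)⁻¹ := by
  have hmul (G E : Matrix (Fin 3) (Fin 3) ℝ) (j l : Fin 3) :
      (G * E * G.transpose) j l = ∑ a, ∑ b, G j a * G l b * E a b := by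
    simp only [Matrix.mul_apply, Matrix.transpose_apply, Finset.sum_mul]
    rw [Finset.sum_comm]
    simp only [mul_right_comm]
  have hmulG (E : Matrix (Fin 3) (Fin 3) ℝ) (j l : Fin 3) :
      ((g x)⁻¹ * E * (g x)⁻¹) j l = ∑ a, ∑ b, (g x)⁻¹ j a * (g x)⁻¹ l b * E a b := by
    rw [← hmul, transpose_inv_metric hg hx]
  ext j l
  rw [Matrix.sub_apply, Matrix.smul_apply, smul_eq_mul, hmulG, mul_comm]
  rfl

/- If `A⁻¹ E A⁻¹ = t A⁻¹` with `t = tr (A⁻¹ E)`, then taking traces gives `t = 3 t`. -/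
theorem inv_mul_mul_inv_sub_smul_eq_zero_iff {A E : Matrix (Fin 3) (Fin 3) ℝ}
    (hA : IsUnit A.det) : A⁻¹ * E * A⁻¹ - (A⁻¹ * E).trace • A⁻¹ = 0 ↔ E = 0 := by
  refine ⟨fun h => ?_, fun h => by simp [h]⟩
  have hE : A⁻¹ * E = (A⁻¹ * E).trace • 1 := by
    have h' := congrArg (· * A) (sub_eq_zero.1 h)
    simpa only [Matrix.nonsing_inv_mul_cancel_right _ _ hA, Matrix.smul_mul,
      Matrix.nonsing_inv_mul _ hA] using h'
  have htrace : (A⁻¹ * E).trace = 0 := by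
    have := congrArg Matrix.trace hE
    rw [Matrix.trace_smul, Matrix.trace_one, Fintype.card_fin, smul_eq_mul] at this
    push_cast at this
    linarith
  rw [htrace, zero_smul] at hE
  rw [← Matrix.mul_nonsing_inv_cancel_left _ E hA, hE, mul_zero]

theorem trace_inv_mul_hess_sub (hg : IsMetricOn g U) (hx : x ∈ U) (hf : ContDiffOn ℝ ∞ f U) :
    ((g x)⁻¹ * Matrix.of (fun a b => hess g f x a b - f x * ricci g x a b)).trace =
      ∑ a, ∑ b, ginv g x a b * hess g f x a b - f x * scalarCurv g x := by
  simp only [Matrix.trace, Matrix.diag, Matrix.mul_apply, Matrix.of_apply, scalarCurv,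
    Finset.mul_sum, ← Finset.sum_sub_distrib]
  refine Finset.sum_congr rfl fun a _ => Finset.sum_congr rfl fun b _ => ?_
  rw [hess_symm hg hx hf b a, hg.ricci_symm hx b a, ginv]
  ring

theorem staticUp_symm (hg : IsMetricOn g U) (hx : x ∈ U) (hf : ContDiffOn ℝ ∞ f U)
    (a b : Fin 3) : staticUp g f x a b = staticUp g f x b a := by
  rw [staticUp, staticUp, hg.ginv_symm hx a b, Finset.sum_comm]
  simp only [mul_comm (ginv g x a _), hess_symm hg hx hf, hg.ricci_symm hx]

theorem staticUp_symm_eq_zero_iff (hg : IsMetricOn g U) (hx : x ∈ U) (hf : ContDiffOn ℝ ∞ f U)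
    (hR : scalarCurv g x = 0) :
    (∀ a b, staticUp g f x a b + staticUp g f x b a = 0) ↔
      ∀ a b, hess g f x a b = f x * ricci g x a b := by
  have htrace := trace_inv_mul_hess_sub hg hx hf
  rw [hR, mul_zero, sub_zero] at htrace
  calc (∀ a b, staticUp g f x a b + staticUp g f x b a = 0)
      ↔ Matrix.of (staticUp g f x) = 0 := by
        simp only [staticUp_symm hg hx hf _, add_self_eq_zero, ← Matrix.ext_iff, Matrix.of_apply,
          Matrix.zero_apply]
    _ ↔ Matrix.of (fun a b => hess g f x a b - f x * ricci g x a b) = 0 := by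
        rw [staticUp_eq hg hx, ← htrace, inv_mul_mul_inv_sub_smul_eq_zero_iff (hg.isUnit_det hx)]
    _ ↔ ∀ a b, hess g f x a b = f x * ricci g x a b := by
        simp only [← Matrix.ext_iff, Matrix.of_apply, Matrix.zero_apply, sub_eq_zero]

theorem lieDeriv_metric (hg : IsMetricOn g U) (hx : x ∈ U) (X : E3 → Fin 3 → ℝ) (i j : Fin 3) :
    lieDeriv X g x i j = ∑ l, (covVec g X x i l * g x l j + g x i l * covVec g X x j l) := by
  have hΓ := hg.christoffel_symm hx
  simp only [lieDeriv, covVec, hg.pd_metric hx, Fin.sum_univ_three, hΓ _ 0 i, hΓ _ 1 i, hΓ _ 2 i,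
    hΓ _ 0 j, hΓ _ 1 j, hΓ _ 2 j]
  ring

theorem covUp_symm_eq_zero_iff (hg : IsMetricOn g U) (hx : x ∈ U) (X : E3 → Fin 3 → ℝ) :
    (∀ a b, covUp g X x a b + covUp g X x b a = 0) ↔ ∀ i j, lieDeriv X g x i j = 0 := by
  set N : Matrix (Fin 3) (Fin 3) ℝ := Matrix.of (covVec g X x)
  have hdet := hg.isUnit_det hx
  have hup : Matrix.of (covUp g X x) = (g x)⁻¹ * N := by
    ext j l
    simp only [Matrix.of_apply, covUp, hg.ginv_symm hx _ j, Matrix.mul_apply, N]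
    rfl
  have hlie : Matrix.of (lieDeriv X g x) = N * g x + (N * g x).transpose := by
    ext i j
    simp only [Matrix.of_apply, lieDeriv_metric hg hx, Finset.sum_add_distrib, Matrix.add_apply,
      Matrix.transpose_apply, Matrix.mul_apply, hg.symm x hx i, mul_comm (covVec g X x j _), N]
  have hconj : Matrix.of (covUp g X x) + (Matrix.of (covUp g X x)).transpose =
      (g x)⁻¹ * Matrix.of (lieDeriv X g x) * (g x)⁻¹ := by
    rw [hlie, hup, Matrix.transpose_mul, Matrix.transpose_mul, transpose_inv_metric hg hx,
      hg.transpose_eq hx, mul_add, add_mul, ← mul_assoc, ← mul_assoc,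
      Matrix.mul_nonsing_inv_cancel_right _ _ hdet, Matrix.nonsing_inv_mul _ hdet, one_mul]
  calc (∀ a b, covUp g X x a b + covUp g X x b a = 0)
      ↔ Matrix.of (covUp g X x) + (Matrix.of (covUp g X x)).transpose = 0 := by
        simp only [← Matrix.ext_iff, Matrix.add_apply, Matrix.transpose_apply, Matrix.of_apply,
          Matrix.zero_apply]
    _ ↔ Matrix.of (lieDeriv X g x) = 0 := by
        rw [hconj]
        refine ⟨fun h => ?_, fun h => by rw [h, mul_zero, zero_mul]⟩
        rw [← Matrix.mul_nonsing_inv_cancel_left _ (Matrix.of _) hdet,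
          ← Matrix.nonsing_inv_mul_cancel_right _ ((g x)⁻¹ * _) hdet, h, zero_mul, mul_zero]
    _ ↔ ∀ i j, lieDeriv X g x i j = 0 := by
        simp only [← Matrix.ext_iff, Matrix.of_apply, Matrix.zero_apply]

theorem forall_setIntegral_pairing_eq_zero_iff_static_killing
    (hg : IsMetricOn g U) (hR : ∀ x ∈ U, scalarCurv g x = 0) (hHm : MeasurableSet H) (hHU : H ⊆ U)
    (hf : ContDiffOn ℝ ∞ f (interior H))
    (hX : ∀ i, ContDiffOn ℝ ∞ (fun y => X y i) (interior H)) :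
    (∀ h w, IsTest H h → IsTest H w → ∫ x in H, pairing g h w f X x = 0) ↔
      IsStaticPotential g f (interior H) ∧ IsKilling g X (interior H) := by
  have hgH := hg.mono isOpen_interior (interior_subset.trans hHU)
  rw [forall_setIntegral_pairing_eq_zero_iff hg hHm hHU hf hX, IsStaticPotential, IsKilling,
    ← forall₂_and]
  refine forall₂_congr fun x hx => ?_
  rw [← staticUp_symm_eq_zero_iff hgH hx hf (hR x (hHU (interior_subset hx))),
    ← covUp_symm_eq_zero_iff hgH hx]
  simp only [forall_and]

end StaticKilling

/-! ### Killing fields preserve the Ricci tensor -/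

section LieDerivative

/-- The Lie derivative `(L_X Γ)^k_{ij}` of the Levi-Civita connection, a tensor. -/
def lieChristoffel (g : Tensor2) (X : E3 → Fin 3 → ℝ) (k i j : Fin 3) (x : E3) : ℝ :=
  pd i (pd j fun y => X y k) x + ∑ n, (X x n * pd n (christoffel g k i j) x
    - christoffel g n i j x * pd n (fun y => X y k) x
    + christoffel g k n j x * pd i (fun y => X y n) x
    + christoffel g k i n x * pd j (fun y => X y n) x)

variable {g T : Tensor2} {U : Set E3} {x : E3} {X : E3 → Fin 3 → ℝ}

theorem hasGrad_lieDeriv (hU : IsOpen U) (hT : ∀ i j, ContDiffOn ℝ ∞ (fun y => T y i j) U)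
    (hX : ∀ i, ContDiffOn ℝ ∞ (fun y => X y i) U) (hx : x ∈ U) (i j : Fin 3) :
    HasGrad (fun y => lieDeriv X T y i j) (fun k => ∑ l,
      (pd k (fun y => X y l) x * pd l (fun y => T y i j) x
        + X x l * pd l (pd k fun y => T y i j) x
        + (pd k (pd i fun y => X y l) x * T x l j
          + pd i (fun y => X y l) x * pd k (fun y => T y l j) x
        + (pd k (pd j fun y => X y l) x * T x i l
          + pd j (fun y => X y l) x * pd k (fun y => T y i l) x)))) x := by
  have dX := fun l => hasGrad_of_contDiffOn hU (hX l) hx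
  have dT := fun a b => hasGrad_of_contDiffOn hU (hT a b) hx
  have ddX := fun l a => hasGrad_of_contDiffOn hU (contDiffOn_pd hU (hX l) a) hx
  have ddT := fun l => hasGrad_of_contDiffOn hU (contDiffOn_pd hU (hT i j) l) hx
  refine (HasGrad.sum Finset.univ fun l _ => ((dX l).mul (ddT l)).add
    (((ddX l i).mul (dT l j)).add ((ddX l j).mul (dT i l)))).congr_grad fun k =>
      Finset.sum_congr rfl fun l _ => ?_
  rw [pd_comm hU (hT i j) hx k l]

theorem sum_mul_lieChristoffel (hg : IsMetricOn g U) (hX : ∀ i, ContDiffOn ℝ ∞ (fun y => X y i) U)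
    (hx : x ∈ U) (l i j : Fin 3) :
    ∑ k, g x l k * lieChristoffel g X k i j x =
      (1 / 2) * (pd i (fun y => lieDeriv X g y j l) x + pd j (fun y => lieDeriv X g y i l) x
        - pd l (fun y => lieDeriv X g y i j) x)
      - ∑ k, lieDeriv X g x l k * christoffel g k i j x := by
  have hU := hg.isOpen
  have hpp := fun a b c => hasGrad_of_contDiffOn hU (contDiffOn_pd hU (hg.smooth b c) a) hx
  have hS (n : Fin 3) : ∑ k, (pd n (fun y => g y l k) x * christoffel g k i j x
      + g x l k * pd n (christoffel g k i j) x) = (1 / 2) * (pd n (pd i fun y => g y j l) x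
      + pd n (pd j fun y => g y i l) x - pd n (pd l fun y => g y i j) x) :=
    ((HasGrad.sum Finset.univ fun k _ => (hg.hasGrad hx l k).mul
      (hg.hasGrad_christoffel hx k i j)).pd_eq n).symm.trans
      ((pd_congr hU (fun y hy => hg.sum_mul_christoffel hy l i j) hx n).trans
      (((((hpp i j l).add (hpp j i l)).sub (hpp l i j)).const_mul (1 / 2)).pd_eq n))
  have hS₁ (n : Fin 3) := hg.sum_mul_christoffel hx l n j
  have hS₂ (n : Fin 3) := hg.sum_mul_christoffel hx l i n
  have hS₃ := hg.sum_mul_christoffel hx 0 i j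
  have hS₄ := hg.sum_mul_christoffel hx 1 i j
  have hS₅ := hg.sum_mul_christoffel hx 2 i j
  have hX₁ (n : Fin 3) := pd_comm hU (hX n) hx j i
  have hX₂ (n : Fin 3) := pd_comm hU (hX n) hx l i
  have hX₃ (n : Fin 3) := pd_comm hU (hX n) hx l j
  have hs := fun a b => hg.symm x hx a b
  have hs₁ := fun a b c => pd_congr hU (fun y hy => hg.symm y hy b c) hx a
  have hs₂ := fun a b c d => pd_congr hU (fun y hy =>
    pd_congr hU (fun z hz => hg.symm z hz c d) hy b) hx a
  have hL := fun a b => hasGrad_lieDeriv hU hg.smooth hX hx a b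
  rw [(hL j l).pd_eq, (hL i l).pd_eq, (hL i j).pd_eq]
  simp only [lieChristoffel, lieDeriv, hX₁, hX₂, hX₃]
  simp only [Fin.sum_univ_three, hs, hs₁, hs₂] at hS hS₁ hS₂ hS₃ hS₄ hS₅ ⊢
  linear_combination X x 0 * hS 0 + X x 1 * hS 1 + X x 2 * hS 2
    + pd i (fun y => X y 0) x * hS₁ 0 + pd i (fun y => X y 1) x * hS₁ 1
    + pd i (fun y => X y 2) x * hS₁ 2 + pd j (fun y => X y 0) x * hS₂ 0
    + pd j (fun y => X y 1) x * hS₂ 1 + pd j (fun y => X y 2) x * hS₂ 2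
    + pd l (fun y => X y 0) x * hS₃ + pd l (fun y => X y 1) x * hS₄
    + pd l (fun y => X y 2) x * hS₅

theorem IsKilling.lieChristoffel_eq_zero (hK : IsKilling g X U) (hg : IsMetricOn g U)
    (hX : ∀ i, ContDiffOn ℝ ∞ (fun y => X y i) U) (hx : x ∈ U) (k i j : Fin 3) :
    lieChristoffel g X k i j x = 0 := by
  have hpd (a b c : Fin 3) : pd a (fun y => lieDeriv X g y b c) x = 0 := by
    rw [pd_congr hg.isOpen (fun y hy => hK y hy b c) hx]
    exact (HasGrad.const 0).pd_eq a
  have hmul : (g x).mulVec (fun k => lieChristoffel g X k i j x) = 0 := by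
    ext l
    calc ∑ k, g x l k * lieChristoffel g X k i j x = _ := sum_mul_lieChristoffel hg hX hx l i j
      _ = 0 := by simp only [hpd, hK x hx, zero_mul, Finset.sum_const_zero, add_zero, sub_zero,
        mul_zero]
  exact congrFun (Matrix.eq_zero_of_mulVec_eq_zero (hg.det_pos x hx).ne' hmul) k

theorem hasGrad_lieChristoffel (hg : IsMetricOn g U)
    (hX : ∀ i, ContDiffOn ℝ ∞ (fun y => X y i) U) (hx : x ∈ U) (k i j : Fin 3) :
    HasGrad (lieChristoffel g X k i j) (fun p => pd p (pd i (pd j fun y => X y k)) x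
      + ∑ n, (pd p (fun y => X y n) x * pd n (christoffel g k i j) x
        + X x n * pd n (pd p (christoffel g k i j)) x
        - (pd p (christoffel g n i j) x * pd n (fun y => X y k) x
          + christoffel g n i j x * pd p (pd n fun y => X y k) x)
        + (pd p (christoffel g k n j) x * pd i (fun y => X y n) x
          + christoffel g k n j x * pd p (pd i fun y => X y n) x)
        + (pd p (christoffel g k i n) x * pd j (fun y => X y n) x
          + christoffel g k i n x * pd p (pd j fun y => X y n) x))) x := by
  have hU := hg.isOpen
  have dX := fun l => hasGrad_of_contDiffOn hU (hX l) hx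
  have ddX := fun l a => hasGrad_of_contDiffOn hU (contDiffOn_pd hU (hX l) a) hx
  have dddX := hasGrad_of_contDiffOn hU (contDiffOn_pd hU (contDiffOn_pd hU (hX k) j) i) hx
  have dΓ := hg.hasGrad_christoffel hx
  have ddΓ := fun n => hasGrad_of_contDiffOn hU
    (contDiffOn_pd hU (hg.contDiffOn_christoffel k i j) n) hx
  refine (dddX.add (HasGrad.sum Finset.univ fun n _ => ((((dX n).mul (ddΓ n)).sub
    ((dΓ n i j).mul (ddX k n))).add ((dΓ k n j).mul (ddX n i))).add
      ((dΓ k i n).mul (ddX n j)))).congr_grad fun p => ?_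
  simp only [pd_comm hU (hg.contDiffOn_christoffel k i j) hx p]

/- All terms with second or third derivatives of `X` cancel, so only `L_X Γ` survives. -/
theorem lieDeriv_ricci (hg : IsMetricOn g U) (hX : ∀ i, ContDiffOn ℝ ∞ (fun y => X y i) U)
    (hx : x ∈ U) (i j : Fin 3) :
    lieDeriv X (fun y => Matrix.of (ricci g y)) x i j =
      ∑ k, (pd k (lieChristoffel g X k i j) x - pd j (lieChristoffel g X k i k) x
        + ∑ l, (lieChristoffel g X k k l x * christoffel g l i j x
          + christoffel g k k l x * lieChristoffel g X l i j x
          - (lieChristoffel g X k j l x * christoffel g l i k x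
            + christoffel g k j l x * lieChristoffel g X l i k x))) := by
  have hU := hg.isOpen
  have hpd := fun {u} => contDiffOn_pd (u := u) hU
  have dΓ := hg.hasGrad_christoffel hx
  have ddΓ := fun k i j n => hasGrad_of_contDiffOn hU (hpd (hg.contDiffOn_christoffel k i j) n) hx
  have hRic (n : Fin 3) : pd n (fun y => ricci g y i j) x = _ :=
    (HasGrad.sum Finset.univ fun k _ => ((ddΓ k i j k).sub (ddΓ k i k j)).add
      (HasGrad.sum Finset.univ fun l _ => ((dΓ k k l).mul (dΓ l i j)).sub
        ((dΓ k j l).mul (dΓ l i k)))).pd_eq n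
  have hX₂ := fun a b n => pd_comm hU (hX n) hx a b
  have hX₃ (k : Fin 3) :
      pd j (pd i (pd k fun y => X y k)) x = pd k (pd i (pd j fun y => X y k)) x := by
    rw [pd_congr hU (fun y hy => pd_comm hU (hX k) hy i k) hx j, pd_comm hU (hpd (hX k) i) hx j k,
      pd_congr hU (fun y hy => pd_comm hU (hX k) hy j i) hx k]
  have hΓ := hg.christoffel_symm hx
  have hΓ₁ := fun a k i j => pd_congr hU (fun y hy => hg.christoffel_symm hy k i j) hx a
  simp only [fun k i j p => (hasGrad_lieChristoffel hg hX hx k i j).pd_eq p, hX₃]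
  simp only [lieDeriv, lieChristoffel, Matrix.of_apply]
  simp only [hRic]
  simp only [ricci, Fin.sum_univ_three, hX₂, hΓ, hΓ₁]
  ring

theorem IsKilling.lieDeriv_ricci_eq_zero (hK : IsKilling g X U) (hg : IsMetricOn g U)
    (hX : ∀ i, ContDiffOn ℝ ∞ (fun y => X y i) U) (hx : x ∈ U) (i j : Fin 3) :
    lieDeriv X (fun y => Matrix.of (ricci g y)) x i j = 0 := by
  have hL := fun y (hy : y ∈ U) k i j => hK.lieChristoffel_eq_zero hg hX hy k i j
  have hpd (p k i j : Fin 3) : pd p (lieChristoffel g X k i j) x = 0 := by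
    rw [pd_congr hg.isOpen (fun y hy => hL y hy k i j) hx]
    exact (HasGrad.const 0).pd_eq p
  simp only [lieDeriv_ricci hg hX hx, hpd, hL x hx, zero_mul, mul_zero, add_zero, sub_zero,
    Finset.sum_const_zero]

end LieDerivative

/-! ### The Schwarzschild metric in Cartesian coordinates -/

section Schwarzschild

/-- The region outside the horizon and the origin. -/
def exterior (m : ℝ) : Set E3 := {x | 0 < ‖x‖ ∧ 2 * m < ‖x‖}

/-- The tensor field `p δ_{ij} + q x_i x_j`. -/
def radialTensor (p q : E3 → ℝ) : Tensor2 := fun x => Matrix.of fun i j =>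
  p x * (if i = j then 1 else 0) + q x * (x i * x j)

variable {m : ℝ} {x : E3} {p q : E3 → ℝ} {P Q : Fin 3 → ℝ}

theorem sum_coord_mul_self (x : E3) : ∑ k, x k * x k = ‖x‖ ^ 2 := by
  rw [norm_sq_eq_sum, Fin.sum_univ_three]
  ring

theorem HasGrad.radial {F : ℝ → ℝ} {F' : ℝ} (hx : x ≠ 0) (hF : HasDerivAt F F' ‖x‖) :
    HasGrad (fun y => F ‖y‖) (fun i => F' / ‖x‖ * x i) x :=
  (HasGrad.comp_hasDerivAt hF (.norm hx)).congr_grad fun i => by ring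

theorem HasGrad.radialTensor (hp : HasGrad p P x) (hq : HasGrad q Q x) (i j : Fin 3) :
    HasGrad (fun y => radialTensor p q y i j) (fun k => P k * (if i = j then 1 else 0)
      + (Q k * (x i * x j)
        + q x * ((if k = i then 1 else 0) * x j + x i * (if k = j then 1 else 0)))) x :=
  ((hp.mul (.const _)).add (hq.mul ((HasGrad.coord i).mul (.coord j)))).congr_grad fun k => by ring

theorem contDiffOn_coord (U : Set E3) (i : Fin 3) : ContDiffOn ℝ ∞ (fun y : E3 => y i) U :=
  (EuclideanSpace.proj i : E3 →L[ℝ] ℝ).contDiff.contDiffOn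

theorem isOpen_exterior (m : ℝ) : IsOpen (exterior m) :=
  (isOpen_lt continuous_const continuous_norm).inter (isOpen_lt continuous_const continuous_norm)

theorem ne_zero_of_mem_exterior (hx : x ∈ exterior m) : x ≠ 0 := norm_pos_iff.1 hx.1

theorem norm_sub_pos_of_mem_exterior (hx : x ∈ exterior m) : 0 < ‖x‖ - 2 * m := sub_pos.2 hx.2

theorem contDiffOn_norm_exterior : ContDiffOn ℝ ∞ (fun y : E3 => ‖y‖) (exterior m) :=
  fun _ hx => (contDiffAt_norm ℝ (ne_zero_of_mem_exterior hx)).contDiffWithinAt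

theorem schwarzschild_eq_radialTensor (hx : x ∈ exterior m) :
    schwarzschild m x =
      radialTensor (fun _ => 1) (fun y => 2 * m / (‖y‖ ^ 2 * (‖y‖ - 2 * m))) x := by
  have h0 := hx.1.ne'
  have h1 := (norm_sub_pos_of_mem_exterior hx).ne'
  have h2 : (1 - 2 * m / ‖x‖)⁻¹ = ‖x‖ / (‖x‖ - 2 * m) := by
    rw [inv_eq_one_div, one_sub_div h0, one_div_div]
  ext i j
  simp only [schwarzschild, radialTensor, Matrix.of_apply, h2]
  field_simp
  ring

theorem radialTensor_mul_radialTensor {p q p' q' : E3 → ℝ} (x : E3) :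
    radialTensor p q x * radialTensor p' q' x =
      radialTensor (p * p') (p * q' + q * p' + q * q' * fun y => ‖y‖ ^ 2) x := by
  ext i j
  have h : ∑ k, q x * (x i * x k) * (q' x * (x k * x j)) = q x * q' x * ‖x‖ ^ 2 * (x i * x j) := by
    rw [norm_sq_eq_sum, Fin.sum_univ_three]
    ring
  simp only [Matrix.mul_apply, radialTensor, Matrix.of_apply, Pi.mul_apply, Pi.add_apply,
    mul_add, add_mul, Finset.sum_add_distrib, h, mul_ite, ite_mul, mul_one, mul_zero, zero_mul,
    Finset.sum_ite_eq, Finset.sum_ite_eq', Finset.mem_univ, if_true]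
  ring

theorem det_schwarzschild (hx : x ∈ exterior m) :
    (schwarzschild m x).det = ‖x‖ / (‖x‖ - 2 * m) := by
  have h0 := hx.1.ne'
  have h1 := (norm_sub_pos_of_mem_exterior hx).ne'
  have h2 (q : ℝ) : (radialTensor (fun _ => 1) (fun _ => q) x).det = 1 + q * ‖x‖ ^ 2 := by
    rw [norm_sq_eq_sum, Matrix.det_fin_three]
    simp only [radialTensor, Matrix.of_apply, Fin.isValue, Fin.reduceEq, if_true, if_false]
    ring
  rw [schwarzschild_eq_radialTensor hx]
  refine (h2 _).trans ?_
  field_simp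
  ring

theorem isMetricOn_schwarzschild (m : ℝ) : IsMetricOn (schwarzschild m) (exterior m) where
  isOpen := isOpen_exterior m
  smooth i j := by
    have hψ : ContDiffOn ℝ ∞ (fun y : E3 => 2 * m / (‖y‖ ^ 2 * (‖y‖ - 2 * m))) (exterior m) :=
      contDiffOn_const.div ((contDiffOn_norm_exterior.pow 2).mul
        (contDiffOn_norm_exterior.sub contDiffOn_const)) fun x hx =>
          mul_ne_zero (pow_ne_zero _ hx.1.ne') (norm_sub_pos_of_mem_exterior hx).ne'
    refine ((contDiffOn_const (c := 1)).mul
      (contDiffOn_const (c := if i = j then (1 : ℝ) else 0)) |>.add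
      (hψ.mul ((contDiffOn_coord _ i).mul (contDiffOn_coord _ j)))).congr fun y hy => ?_
    rw [schwarzschild_eq_radialTensor hy]
    rfl
  symm x _ i j := by
    simp only [schwarzschild, Matrix.of_apply, eq_comm (a := i) (b := j), mul_comm (x i / _)]
  det_pos x hx := by
    rw [det_schwarzschild hx]
    exact div_pos hx.1 (norm_sub_pos_of_mem_exterior hx)

theorem ginv_schwarzschild (hx : x ∈ exterior m) (i j : Fin 3) :
    ginv (schwarzschild m) x i j =
      radialTensor (fun _ => 1) (fun y => -(2 * m / ‖y‖ ^ 3)) x i j := by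
  have h0 := hx.1.ne'
  have h1 := (norm_sub_pos_of_mem_exterior hx).ne'
  rw [ginv, Matrix.inv_eq_right_inv]
  rw [schwarzschild_eq_radialTensor hx, radialTensor_mul_radialTensor]
  ext a b
  simp only [radialTensor, Matrix.of_apply, Pi.mul_apply, Pi.add_apply, Matrix.one_apply]
  rw [mul_one, one_mul, add_eq_left, mul_eq_zero]
  left
  field_simp
  ring

theorem hasGrad_schwarzschild_coeff (hx : x ∈ exterior m) :
    HasGrad (fun y => 2 * m / (‖y‖ ^ 2 * (‖y‖ - 2 * m)))
      (fun i => -(2 * m * (3 * ‖x‖ - 4 * m)) / (‖x‖ ^ 4 * (‖x‖ - 2 * m) ^ 2) * x i) x := by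
  have h0 := hx.1.ne'
  have h1 := (norm_sub_pos_of_mem_exterior hx).ne'
  have hψ : HasDerivAt (fun r => 2 * m / (r ^ 2 * (r - 2 * m)))
      (-(2 * m * (3 * ‖x‖ - 4 * m)) / (‖x‖ ^ 3 * (‖x‖ - 2 * m) ^ 2)) ‖x‖ := by
    refine ((hasDerivAt_const ‖x‖ (2 * m)).fun_div
      (((hasDerivAt_id ‖x‖).fun_pow 2).fun_mul ((hasDerivAt_id ‖x‖).sub_const (2 * m)))
      (mul_ne_zero (pow_ne_zero 2 h0) h1)).congr_deriv ?_
    simp only [id]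
    push_cast
    field_simp
    ring
  exact (HasGrad.radial (ne_zero_of_mem_exterior hx) hψ).congr_grad fun i => by field_simp

theorem hasGrad_schwarzschild (hx : x ∈ exterior m) (i j : Fin 3) :
    HasGrad (fun y => schwarzschild m y i j) (fun k =>
      -(2 * m * (3 * ‖x‖ - 4 * m)) / (‖x‖ ^ 4 * (‖x‖ - 2 * m) ^ 2) * (x k * (x i * x j))
        + 2 * m / (‖x‖ ^ 2 * (‖x‖ - 2 * m))
          * ((if k = i then 1 else 0) * x j + x i * (if k = j then 1 else 0))) x :=
  (((HasGrad.const 1).radialTensor (hasGrad_schwarzschild_coeff hx) i j).congr_of_eqOn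
    (isOpen_exterior m) hx fun y hy => by rw [schwarzschild_eq_radialTensor hy]).congr_grad
      fun k => by ring

theorem christoffel_schwarzschild (hx : x ∈ exterior m) (k i j : Fin 3) :
    christoffel (schwarzschild m) k i j x =
      x k * radialTensor (fun y => 2 * m / ‖y‖ ^ 3)
        (fun y => -(m * (3 * ‖y‖ - 4 * m)) / (‖y‖ ^ 5 * (‖y‖ - 2 * m))) x i j := by
  have h0 := hx.1.ne'
  have h1 := (norm_sub_pos_of_mem_exterior hx).ne'
  have hterm (l : Fin 3) : ginv (schwarzschild m) x k l *
      (pd i (fun y => schwarzschild m y j l) x + pd j (fun y => schwarzschild m y i l) x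
        - pd l (fun y => schwarzschild m y i j) x)
      = ((if k = l then 1 else 0) * x l - 2 * m / ‖x‖ ^ 3 * x k * (x l * x l)) *
        (-(2 * m * (3 * ‖x‖ - 4 * m)) / (‖x‖ ^ 4 * (‖x‖ - 2 * m) ^ 2) * (x i * x j)
          + 2 * (2 * m / (‖x‖ ^ 2 * (‖x‖ - 2 * m))) * (if i = j then 1 else 0)) := by
    rw [(hasGrad_schwarzschild hx j l).pd_eq, (hasGrad_schwarzschild hx i l).pd_eq,
      (hasGrad_schwarzschild hx i j).pd_eq, ginv_schwarzschild hx]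
    simp only [radialTensor, Matrix.of_apply, eq_comm (a := j) (b := i), eq_comm (a := l)]
    ring
  have hsum : ∑ l, ((if k = l then 1 else 0) * x l - 2 * m / ‖x‖ ^ 3 * x k * (x l * x l))
      = x k * ((‖x‖ - 2 * m) / ‖x‖) := by
    simp only [Finset.sum_sub_distrib, ite_mul, one_mul, zero_mul, Finset.sum_ite_eq,
      Finset.mem_univ, if_true, ← Finset.mul_sum, sum_coord_mul_self]
    field_simp
  rw [christoffel, Finset.sum_congr rfl fun l _ => hterm l, ← Finset.sum_mul, hsum]
  simp only [radialTensor, Matrix.of_apply]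
  field_simp
  ring

theorem ricci_of_christoffel_eq_radialTensor {g : Tensor2} {U : Set E3} {φ A : E3 → ℝ} {φ' A' : ℝ}
    (hU : IsOpen U) (hx : x ∈ U)
    (hΓ : ∀ y ∈ U, ∀ k i j, christoffel g k i j y = y k * radialTensor φ A y i j)
    (hφ : HasGrad φ (fun i => φ' * x i) x) (hA : HasGrad A (fun i => A' * x i) x) (i j : Fin 3) :
    ricci g x i j =
      (2 * φ x + φ' * ‖x‖ ^ 2 - A x * ‖x‖ ^ 2 + φ x * (A x * ‖x‖ ^ 2 + φ x) * ‖x‖ ^ 2)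
          * (if i = j then 1 else 0)
        + (3 * A x - φ' - φ x * (A x * ‖x‖ ^ 2 + φ x)) * (x i * x j) := by
  have hpd (n k a b : Fin 3) :=
    (((HasGrad.coord k).mul (hφ.radialTensor hA a b)).congr_of_eqOn hU hx
      fun y hy => hΓ y hy k a b).pd_eq n
  simp only [ricci, hpd, hΓ x hx, radialTensor, Matrix.of_apply, norm_sq_eq_sum, Fin.sum_univ_three]
  fin_cases i <;> fin_cases j <;>
    simp only [Fin.zero_eta, Fin.mk_one, Fin.reduceFinMk, Fin.reduceEq, if_true, if_false] <;> ring

theorem ricci_schwarzschild (hx : x ∈ exterior m) (i j : Fin 3) :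
    ricci (schwarzschild m) x i j = radialTensor (fun y => m / ‖y‖ ^ 3)
      (fun y => -(m * (3 * ‖y‖ - 2 * m)) / (‖y‖ ^ 5 * (‖y‖ - 2 * m))) x i j := by
  have h0 := hx.1.ne'
  have h1 := (norm_sub_pos_of_mem_exterior hx).ne'
  have h1' : ‖x‖ - m * 2 ≠ 0 := by rwa [mul_comm m]
  have hA : HasDerivAt (fun r => -(m * (3 * r - 4 * m)) / (r ^ 5 * (r - 2 * m)))
      (m * (15 * ‖x‖ ^ 2 - 48 * m * ‖x‖ + 40 * m ^ 2) / (‖x‖ ^ 6 * (‖x‖ - 2 * m) ^ 2)) ‖x‖ := by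
    refine (((((hasDerivAt_id ‖x‖).const_mul 3).sub_const (4 * m)).const_mul m).fun_neg.fun_div
      (((hasDerivAt_id ‖x‖).fun_pow 5).fun_mul ((hasDerivAt_id ‖x‖).sub_const (2 * m)))
      (mul_ne_zero (pow_ne_zero 5 h0) h1)).congr_deriv ?_
    simp only [id]
    push_cast
    field_simp
    ring
  have hφ : HasDerivAt (fun r => 2 * m / r ^ 3) (-(6 * m) / ‖x‖ ^ 4) ‖x‖ := by
    refine ((hasDerivAt_const ‖x‖ (2 * m)).fun_div ((hasDerivAt_id ‖x‖).fun_pow 3)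
      (pow_ne_zero 3 h0)).congr_deriv ?_
    simp only [id]
    push_cast
    field_simp
    ring
  have hne := ne_zero_of_mem_exterior hx
  rw [ricci_of_christoffel_eq_radialTensor (isOpen_exterior m) hx
    (fun y hy => christoffel_schwarzschild hy) (.radial hne hφ) (.radial hne hA)]
  simp only [radialTensor, Matrix.of_apply]
  congr 2 <;> field_simp <;> ring

theorem sum_radialTensor_mul_radialTensor (p q p' q' : E3 → ℝ) (x : E3) :
    ∑ i, ∑ j, radialTensor p q x i j * radialTensor p' q' x i j =
      3 * (p x * p' x) + (p x * q' x + q x * p' x) * ‖x‖ ^ 2 + q x * q' x * ‖x‖ ^ 4 := by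
  simp only [radialTensor, Matrix.of_apply, Fin.sum_univ_three, Fin.reduceEq, if_true, if_false]
  rw [show ‖x‖ ^ 4 = (‖x‖ ^ 2) ^ 2 by ring, norm_sq_eq_sum]
  ring

theorem scalarCurv_schwarzschild (hx : x ∈ exterior m) : scalarCurv (schwarzschild m) x = 0 := by
  have h0 := hx.1.ne'
  have h1 := (norm_sub_pos_of_mem_exterior hx).ne'
  have h1' : ‖x‖ - m * 2 ≠ 0 := by rwa [mul_comm m]
  simp only [scalarCurv, ginv_schwarzschild hx, ricci_schwarzschild hx,
    sum_radialTensor_mul_radialTensor]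
  field_simp
  ring

theorem lapse_pos (hx : x ∈ exterior m) : 0 < lapse m x :=
  Real.sqrt_pos.2 (sub_pos.2 ((div_lt_one hx.1).2 hx.2))

theorem lapse_sq (hx : x ∈ exterior m) : lapse m x ^ 2 = (‖x‖ - 2 * m) / ‖x‖ := by
  rw [lapse, Real.sq_sqrt (Real.sqrt_pos.1 (lapse_pos hx)).le, one_sub_div hx.1.ne']

theorem contDiffOn_lapse : ContDiffOn ℝ ∞ (lapse m) (exterior m) :=
  (contDiffOn_const.sub (contDiffOn_const.div contDiffOn_norm_exterior fun _ hx => hx.1.ne')).sqrt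
    fun _ hx => (Real.sqrt_pos.1 (lapse_pos hx)).ne'

theorem hasDerivAt_sqrt_one_sub_div {r : ℝ} (hr : 0 < r) (hm : 2 * m < r) :
    HasDerivAt (fun r => Real.sqrt (1 - 2 * m / r))
      (m / (r ^ 2 * Real.sqrt (1 - 2 * m / r))) r := by
  have hpos : 0 < 1 - 2 * m / r := sub_pos.2 ((div_lt_one hr).2 hm)
  have hsqrt := (Real.sqrt_pos.2 hpos).ne'
  refine ((((hasDerivAt_const r (2 * m)).fun_div (hasDerivAt_id r) hr.ne').const_sub 1).sqrt
    hpos.ne').congr_deriv ?_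
  simp only [id]
  field_simp [hsqrt]
  ring

theorem hasGrad_lapse (hx : x ∈ exterior m) :
    HasGrad (lapse m) (fun i => m / (‖x‖ ^ 3 * lapse m x) * x i) x := by
  have h0 := hx.1.ne'
  exact (HasGrad.radial (ne_zero_of_mem_exterior hx)
    (hasDerivAt_sqrt_one_sub_div hx.1 hx.2)).congr_grad fun i => by
      rw [← lapse]
      field_simp

theorem hasGrad_pd_lapse (hx : x ∈ exterior m) (b : Fin 3) :
    HasGrad (pd b (lapse m)) (fun a => m / (‖x‖ ^ 3 * lapse m x) * (if a = b then 1 else 0)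
      - m * (3 * ‖x‖ - 5 * m) / (‖x‖ ^ 6 * lapse m x ^ 3) * (x a * x b)) x := by
  have h0 := hx.1.ne'
  have hN := lapse_pos hx
  have h : HasDerivAt (fun r => m / (r ^ 3 * Real.sqrt (1 - 2 * m / r)))
      (-(m * (3 * ‖x‖ - 5 * m)) / (‖x‖ ^ 5 * lapse m x ^ 3)) ‖x‖ := by
    refine ((hasDerivAt_const ‖x‖ m).fun_div (((hasDerivAt_id ‖x‖).fun_pow 3).fun_mul
      (hasDerivAt_sqrt_one_sub_div hx.1 hx.2)) (mul_pos (pow_pos hx.1 3) hN).ne').congr_deriv ?_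
    rw [← lapse]
    simp only [id]
    push_cast
    have := lapse_sq hx
    field_simp at this ⊢
    linear_combination (-3 * m) * this
  refine (((HasGrad.radial (ne_zero_of_mem_exterior hx) h).mul (.coord b)).congr_of_eqOn
    (isOpen_exterior m) hx fun y hy => (hasGrad_lapse hy).pd_eq b).congr_grad fun a => ?_
  rw [← lapse]
  field_simp
  ring

theorem isStaticPotential_lapse (m : ℝ) :
    IsStaticPotential (schwarzschild m) (lapse m) (exterior m) := by
  intro x hx a b
  have h0 := hx.1.ne'
  have h1 := (norm_sub_pos_of_mem_exterior hx).ne'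
  have hN := (lapse_pos hx).ne'
  have h1' : ‖x‖ - m * 2 ≠ 0 := by rwa [mul_comm m]
  have hsum (S : ℝ) : ∑ k, x k * S * (m / (‖x‖ ^ 3 * lapse m x) * x k) =
      S * (m / (‖x‖ ^ 3 * lapse m x)) * ‖x‖ ^ 2 := by
    rw [← sum_coord_mul_self, Finset.mul_sum]
    exact Finset.sum_congr rfl fun k _ => by ring
  simp only [hess, (hasGrad_pd_lapse hx b).pd_eq, (hasGrad_lapse hx).pd_eq,
    christoffel_schwarzschild hx, ricci_schwarzschild hx, hsum]
  have hcube : lapse m x ^ 3 = lapse m x * ((‖x‖ - 2 * m) / ‖x‖) := by rw [← lapse_sq hx]; ring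
  have hinv : lapse m x = (‖x‖ - 2 * m) / (‖x‖ * lapse m x) := by
    rw [← div_div, ← lapse_sq hx, sq, mul_div_cancel_right₀ _ hN]
  rw [hcube]
  conv_rhs => rw [hinv]
  simp only [radialTensor, Matrix.of_apply]
  field_simp
  ring

end Schwarzschild

/-! ### Killing fields of the Schwarzschild metric -/

section Rotations

/-- The radial part `⟨x, X⟩` of a vector field, in the Euclidean inner product. -/
def radialPart (X : E3 → Fin 3 → ℝ) (x : E3) : ℝ := ∑ k, x k * X x k

/-- The matrix of the cross product with `c`, that is, of the infinitesimal rotation about `c`. -/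
def rotationMatrix (c : Fin 3 → ℝ) : Matrix (Fin 3) (Fin 3) ℝ :=
  !![0, -c 2, c 1; c 2, 0, -c 0; -c 1, c 0, 0]

/-- The infinitesimal rotation about `c`, as a vector field. -/
def rotationField (c : Fin 3 → ℝ) (x : E3) : Fin 3 → ℝ := fun i => ∑ k, rotationMatrix c i k * x k

variable {m : ℝ} {U : Set E3} {x : E3} {X : E3 → Fin 3 → ℝ} {p q : E3 → ℝ} {p' q' : ℝ}

theorem rotationField_eq (c : Fin 3 → ℝ) (x : E3) :
    rotationField c x = c 0 • rot1 x + c 1 • rot2 x + c 2 • rot3 x := by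
  ext i
  rw [rotationField, Fin.sum_univ_three]
  fin_cases i <;>
    simp only [rotationMatrix, rot1, rot2, rot3, Matrix.of_apply, Matrix.cons_val, Fin.zero_eta,
      Fin.mk_one, Fin.reduceFinMk, Pi.add_apply, Pi.smul_apply, smul_eq_mul] <;>
    ring

theorem rotationField_zero (x : E3) : rotationField 0 x = 0 := by
  simp only [rotationField_eq, Pi.zero_apply, zero_smul, add_zero]

theorem rotationMatrix_antisymm (c : Fin 3 → ℝ) (i j : Fin 3) :
    rotationMatrix c i j + rotationMatrix c j i = 0 := by
  fin_cases i <;> fin_cases j <;> simp [rotationMatrix]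

theorem exists_eq_rotationMatrix {W : Matrix (Fin 3) (Fin 3) ℝ} (hW : ∀ i j, W i j + W j i = 0) :
    ∃ c, W = rotationMatrix c := by
  have hdiag (i : Fin 3) : W i i = 0 := by linarith [hW i i]
  refine ⟨![W 2 1, W 0 2, W 1 0], ?_⟩
  ext i j
  fin_cases i <;> fin_cases j <;>
    simp [rotationMatrix, hdiag, eq_neg_iff_add_eq_zero, hW]

theorem hasGrad_rotationField (c : Fin 3 → ℝ) (x : E3) (i : Fin 3) :
    HasGrad (fun y => rotationField c y i) (rotationMatrix c i) x :=
  (HasGrad.sum Finset.univ fun k _ => (HasGrad.coord k).const_mul (rotationMatrix c i k)).congr_grad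
    fun j => by simp

theorem contDiffOn_rotationField (c : Fin 3 → ℝ) (U : Set E3) (i : Fin 3) :
    ContDiffOn ℝ ∞ (fun y => rotationField c y i) U :=
  ContDiffOn.sum fun k _ => contDiffOn_const.mul (contDiffOn_coord U k)

theorem radialPart_rotationField (c : Fin 3 → ℝ) (x : E3) :
    radialPart (rotationField c) x = 0 := by
  rw [radialPart, rotationField_eq, Fin.sum_univ_three]
  simp only [rot1, rot2, rot3, Pi.add_apply, Pi.smul_apply, smul_eq_mul, Matrix.cons_val]
  ring

theorem hasGrad_radialPart (hX : ∀ k, DifferentiableAt ℝ (fun y => X y k) x) :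
    HasGrad (radialPart X) (fun i => X x i + ∑ k, x k * pd i (fun y => X y k) x) x :=
  (HasGrad.sum Finset.univ fun k _ =>
    (HasGrad.coord k).mul (.of_differentiableAt (hX k))).congr_grad fun i => by
      simp [Finset.sum_add_distrib]

theorem lieDeriv_congr {T T' : Tensor2} (hU : IsOpen U) (h : ∀ y ∈ U, T y = T' y) (hx : x ∈ U)
    (i j : Fin 3) : lieDeriv X T x i j = lieDeriv X T' x i j := by
  simp only [lieDeriv, h x hx]
  refine Finset.sum_congr rfl fun l _ => ?_
  rw [pd_congr hU (fun y hy => by rw [h y hy]) hx]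

theorem lieDeriv_radialTensor (hp : HasGrad p (fun i => p' * x i) x)
    (hq : HasGrad q (fun i => q' * x i) x) (hX : ∀ k, DifferentiableAt ℝ (fun y => X y k) x)
    (i j : Fin 3) :
    lieDeriv X (radialTensor p q) x i j =
      p' * radialPart X x * (if i = j then 1 else 0)
        + p x * (pd i (fun y => X y j) x + pd j (fun y => X y i) x)
        + (q' * radialPart X x * (x i * x j)
          + q x * (pd i (radialPart X) x * x j + x i * pd j (radialPart X) x)) := by
  simp only [lieDeriv, (hp.radialTensor hq i j).pd_eq, (hasGrad_radialPart hX).pd_eq]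
  simp only [radialTensor, radialPart, Matrix.of_apply, Fin.sum_univ_three]
  fin_cases i <;> fin_cases j <;>
    simp only [Fin.zero_eta, Fin.mk_one, Fin.reduceFinMk, Fin.reduceEq, if_true, if_false] <;> ring

theorem sum_tangential_mul_lieDeriv_radialTensor (hp : HasGrad p (fun i => p' * x i) x)
    (hq : HasGrad q (fun i => q' * x i) x) (hX : ∀ k, DifferentiableAt ℝ (fun y => X y k) x) :
    ∑ i, ∑ j, (‖x‖ ^ 2 * (if i = j then 1 else 0) - x i * x j)
        * lieDeriv X (radialTensor p q) x i j =
      2 * ‖x‖ ^ 2 * p' * radialPart X x + p x * ∑ i, ∑ j,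
        (‖x‖ ^ 2 * (if i = j then 1 else 0) - x i * x j)
          * (pd i (fun y => X y j) x + pd j (fun y => X y i) x) := by
  simp only [lieDeriv_radialTensor hp hq hX, norm_sq_eq_sum, Fin.sum_univ_three, Fin.reduceEq,
    if_true, if_false]
  ring

theorem lieDeriv_schwarzschild (hx : x ∈ exterior m)
    (hX : ∀ k, DifferentiableAt ℝ (fun y => X y k) x) (i j : Fin 3) :
    lieDeriv X (schwarzschild m) x i j = pd i (fun y => X y j) x + pd j (fun y => X y i) x
        + (-(2 * m * (3 * ‖x‖ - 4 * m)) / (‖x‖ ^ 4 * (‖x‖ - 2 * m) ^ 2) * radialPart X x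
            * (x i * x j)
          + 2 * m / (‖x‖ ^ 2 * (‖x‖ - 2 * m))
            * (pd i (radialPart X) x * x j + x i * pd j (radialPart X) x)) := by
  rw [lieDeriv_congr (isOpen_exterior m) (fun y hy => schwarzschild_eq_radialTensor hy) hx]
  refine (lieDeriv_radialTensor ((HasGrad.const 1).congr_grad fun i => (zero_mul (x i)).symm)
    (hasGrad_schwarzschild_coeff hx) hX i j).trans ?_
  ring

theorem radialPart_eq_zero_of_lieDeriv_radialTensor {u v : E3 → ℝ} {u' v' : ℝ} (hx : x ≠ 0)
    (hp : HasGrad p (fun i => p' * x i) x) (hq : HasGrad q (fun i => q' * x i) x)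
    (hu : HasGrad u (fun i => u' * x i) x)
    (hv : HasGrad v (fun i => v' * x i) x) (hX : ∀ k, DifferentiableAt ℝ (fun y => X y k) x)
    (hpq : ∀ i j, lieDeriv X (radialTensor p q) x i j = 0)
    (huv : ∀ i j, lieDeriv X (radialTensor u v) x i j = 0) (hne : p x * u' - p' * u x ≠ 0) :
    radialPart X x = 0 := by
  have h1 := sum_tangential_mul_lieDeriv_radialTensor hp hq hX
  have h2 := sum_tangential_mul_lieDeriv_radialTensor hu hv hX
  simp only [hpq, huv, mul_zero, Finset.sum_const_zero] at h1 h2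
  have h : ‖x‖ ^ 2 * (p x * u' - p' * u x) * radialPart X x = 0 := by
    linear_combination (u x / 2) * h1 - (p x / 2) * h2
  exact (mul_eq_zero.1 h).resolve_left (mul_ne_zero (pow_ne_zero 2 (norm_ne_zero_iff.2 hx)) hne)

theorem IsKilling.radialPart_eq_zero (hK : IsKilling (schwarzschild m) X U) (hm : m ≠ 0)
    (hU : IsOpen U) (hUe : U ⊆ exterior m) (hX : ∀ i, ContDiffOn ℝ ∞ (fun y => X y i) U)
    (hx : x ∈ U) : radialPart X x = 0 := by
  have hxe := hUe hx
  have hx0 := ne_zero_of_mem_exterior hxe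
  have h0 := hxe.1.ne'
  have h1 := (norm_sub_pos_of_mem_exterior hxe).ne'
  have hα : HasGrad (fun y => m / ‖y‖ ^ 3) (fun i => -(3 * m) / ‖x‖ ^ 5 * x i) x := by
    have h : HasDerivAt (fun r => m / r ^ 3) (-(3 * m) / ‖x‖ ^ 4) ‖x‖ := by
      refine ((hasDerivAt_const ‖x‖ m).fun_div ((hasDerivAt_id ‖x‖).fun_pow 3)
        (pow_ne_zero 3 h0)).congr_deriv ?_
      simp only [id]
      push_cast
      field_simp
      ring
    exact (HasGrad.radial hx0 h).congr_grad fun i => by field_simp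
  have hβ : DifferentiableAt ℝ (fun r => -(m * (3 * r - 2 * m)) / (r ^ 5 * (r - 2 * m))) ‖x‖ := by
    fun_prop (disch := exact mul_ne_zero (pow_ne_zero 5 h0) h1)
  refine radialPart_eq_zero_of_lieDeriv_radialTensor hx0
    ((HasGrad.const 1).congr_grad fun i => (zero_mul (x i)).symm)
    (hasGrad_schwarzschild_coeff hxe) hα (.radial hx0 hβ.hasDerivAt)
    (fun k => (hasGrad_of_contDiffOn hU (hX k) hx).differentiableAt) (fun i j => ?_)
    (fun i j => ?_) ?_
  · rw [← hK x hx i j]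
    exact (lieDeriv_congr (isOpen_exterior m) (fun y hy => schwarzschild_eq_radialTensor hy)
      hxe i j).symm
  · rw [← hK.lieDeriv_ricci_eq_zero ((isMetricOn_schwarzschild m).mono hU hUe) hX hx i j]
    exact (lieDeriv_congr (isOpen_exterior m)
      (fun y hy => Matrix.ext fun i j => ricci_schwarzschild hy i j) hxe i j).symm
  · rw [one_mul, zero_mul, sub_zero]
    exact div_ne_zero (neg_ne_zero.2 (mul_ne_zero three_ne_zero hm)) (pow_ne_zero 5 h0)

theorem isKilling_schwarzschild_iff_of_radialPart_eq_zero (hU : IsOpen U) (hUe : U ⊆ exterior m)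
    (hX : ∀ i, ContDiffOn ℝ ∞ (fun y => X y i) U) (hr : ∀ x ∈ U, radialPart X x = 0) :
    IsKilling (schwarzschild m) X U ↔
      ∀ x ∈ U, ∀ i j, pd i (fun y => X y j) x + pd j (fun y => X y i) x = 0 := by
  refine forall₂_congr fun x hx => forall₂_congr fun i j => ?_
  have hpd (i : Fin 3) : pd i (radialPart X) x = 0 :=
    (pd_congr hU hr hx i).trans ((HasGrad.const 0).pd_eq i)
  rw [lieDeriv_schwarzschild (hUe hx)
      fun k => (hasGrad_of_contDiffOn hU (hX k) hx).differentiableAt,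
    hr x hx, hpd, hpd]
  simp only [mul_zero, zero_mul, add_zero]

theorem isKilling_rotationField (hU : IsOpen U) (hUe : U ⊆ exterior m) (c : Fin 3 → ℝ) :
    IsKilling (schwarzschild m) (rotationField c) U := by
  refine (isKilling_schwarzschild_iff_of_radialPart_eq_zero hU hUe
    (contDiffOn_rotationField c U) fun x _ => radialPart_rotationField c x).2 fun x _ i j => ?_
  rw [(hasGrad_rotationField c x i).pd_eq, (hasGrad_rotationField c x j).pd_eq,
    rotationMatrix_antisymm]

theorem pd_pd_eq_zero_of_euclidean_killing (hU : IsOpen U)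
    (hX : ∀ i, ContDiffOn ℝ ∞ (fun y => X y i) U)
    (hK : ∀ x ∈ U, ∀ i j, pd i (fun y => X y j) x + pd j (fun y => X y i) x = 0)
    (hx : x ∈ U) (i j k : Fin 3) : pd i (pd j (fun y => X y k)) x = 0 := by
  have hsymm (a b c : Fin 3) : pd a (pd b (fun y => X y c)) x
      + pd a (pd c (fun y => X y b)) x = 0 := by
    rw [← ((hasGrad_of_contDiffOn hU (contDiffOn_pd hU (hX c) b) hx).add
      (hasGrad_of_contDiffOn hU (contDiffOn_pd hU (hX b) c) hx)).pd_eq a,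
      pd_congr hU (fun y hy => hK y hy b c) hx, (HasGrad.const 0).pd_eq]
  linarith [hsymm i j k, hsymm j k i, hsymm k i j, pd_comm hU (hX j) hx i k,
    pd_comm hU (hX k) hx i j, pd_comm hU (hX i) hx j k]

theorem exists_eq_rotationField_of_euclidean_killing (hU : IsOpen U) (hUc : IsPreconnected U)
    (hX : ∀ i, ContDiffOn ℝ ∞ (fun y => X y i) U)
    (hK : ∀ x ∈ U, ∀ i j, pd i (fun y => X y j) x + pd j (fun y => X y i) x = 0)
    (hr : ∀ x ∈ U, radialPart X x = 0) : ∃ c, ∀ x ∈ U, X x = rotationField c x := by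
  obtain rfl | ⟨x₀, hx₀⟩ := U.eq_empty_or_nonempty
  · exact ⟨0, fun x hx => hx.elim⟩
  choose W hW using fun i k => exists_eq_const_of_pd_eq_zero hU hUc (contDiffOn_pd hU (hX i) k)
    fun x hx c => pd_pd_eq_zero_of_euclidean_killing hU hX hK hx c k i
  have hanti (i j : Fin 3) : W i j + W j i = 0 := by
    rw [← hW i j x₀ hx₀, ← hW j i x₀ hx₀, add_comm]
    exact hK x₀ hx₀ i j
  obtain ⟨c, hc⟩ := exists_eq_rotationMatrix hanti
  refine ⟨c, fun x hx => funext fun i => ?_⟩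
  have h : X x i + ∑ k, x k * W k i = 0 := by
    have hpd := (hasGrad_radialPart fun k =>
      (hasGrad_of_contDiffOn hU (hX k) hx).differentiableAt).pd_eq i
    rw [pd_congr hU hr hx, (HasGrad.const 0).pd_eq] at hpd
    simpa only [hW _ _ x hx] using hpd.symm
  rw [rotationField, ← hc, eq_neg_of_add_eq_zero_left h, ← Finset.sum_neg_distrib]
  exact Finset.sum_congr rfl fun k _ => by linear_combination -x k * hanti k i

theorem IsKilling.exists_eq_rotationField (hK : IsKilling (schwarzschild m) X U) (hm : m ≠ 0)
    (hU : IsOpen U) (hUc : IsPreconnected U) (hUe : U ⊆ exterior m)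
    (hX : ∀ i, ContDiffOn ℝ ∞ (fun y => X y i) U) : ∃ c, ∀ x ∈ U, X x = rotationField c x := by
  have hr (x : E3) (hx : x ∈ U) := hK.radialPart_eq_zero hm hU hUe hX hx
  exact exists_eq_rotationField_of_euclidean_killing hU hUc hX
    ((isKilling_schwarzschild_iff_of_radialPart_eq_zero hU hUe hX hr).1 hK) hr

end Rotations

/-! ### Static potentials of the Schwarzschild metric -/

section StaticPotentials

/-- The vector field `g^{lk} θ_k` associated with a one-form `θ`. -/
def sharp (g : Tensor2) (θ : E3 → Fin 3 → ℝ) (x : E3) (l : Fin 3) : ℝ := ∑ k, ginv g x l k * θ x k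

/-- The covariant derivative `∇_i θ_j` of a one-form. -/
def covForm (g : Tensor2) (θ : E3 → Fin 3 → ℝ) (x : E3) (i j : Fin 3) : ℝ :=
  pd i (fun y => θ y j) x - ∑ n, christoffel g n i j x * θ x n

/-- The Wronskian `f dN - N df` of two functions, as a one-form. -/
def wronskian (f N : E3 → ℝ) (x : E3) (k : Fin 3) : ℝ := f x * pd k N x - N x * pd k f x

variable {g : Tensor2} {m : ℝ} {U : Set E3} {x : E3} {f N : E3 → ℝ} {θ : E3 → Fin 3 → ℝ}
  {c : Fin 3 → ℝ}

theorem sum_mul_sharp (hg : IsMetricOn g U) (hx : x ∈ U) (θ : E3 → Fin 3 → ℝ) (j : Fin 3) :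
    ∑ l, g x j l * sharp g θ x l = θ x j := by
  calc ∑ l, g x j l * sharp g θ x l = ∑ k, (∑ l, g x j l * ginv g x l k) * θ x k := by
        simp only [sharp, Finset.mul_sum, Finset.sum_mul, mul_assoc]
        exact Finset.sum_comm
    _ = θ x j := by
        simp only [hg.sum_mul_ginv hx, ite_mul, one_mul, zero_mul, Finset.sum_ite_eq,
          Finset.mem_univ, if_true]

theorem contDiffOn_sharp (hg : IsMetricOn g U) (hθ : ∀ k, ContDiffOn ℝ ∞ (fun y => θ y k) U)
    (l : Fin 3) : ContDiffOn ℝ ∞ (fun y => sharp g θ y l) U :=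
  ContDiffOn.sum fun k _ => (hg.contDiffOn_ginv l k).mul (hθ k)

theorem covVec_sharp (hg : IsMetricOn g U) (hx : x ∈ U)
    (hθ : ∀ k, ContDiffOn ℝ ∞ (fun y => θ y k) U) (i l : Fin 3) :
    covVec g (sharp g θ) x i l = ∑ k, ginv g x l k * covForm g θ x i k := by
  have h := (HasGrad.sum Finset.univ fun k _ =>
    (hg.hasGrad_ginv hx l k).mul (hasGrad_of_contDiffOn hg.isOpen (hθ k) hx)).pd_eq i
  rw [covVec]
  refine (congrArg (· + _) h).trans ?_
  simp only [covForm, sharp, Fin.sum_univ_three]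
  ring

theorem lieDeriv_sharp (hg : IsMetricOn g U) (hx : x ∈ U)
    (hθ : ∀ k, ContDiffOn ℝ ∞ (fun y => θ y k) U) (i j : Fin 3) :
    lieDeriv (sharp g θ) g x i j = covForm g θ x i j + covForm g θ x j i := by
  have h (i j : Fin 3) : ∑ l, g x j l * covVec g (sharp g θ) x i l = covForm g θ x i j := by
    simp only [covVec_sharp hg hx hθ]
    exact sum_mul_sharp hg hx (fun _ => covForm g θ x i) j
  simp only [lieDeriv_metric hg hx, Finset.sum_add_distrib, hg.symm x hx _ j,
    mul_comm _ (g x j _), h]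

theorem contDiffOn_wronskian (hU : IsOpen U) (hf : ContDiffOn ℝ ∞ f U) (hN : ContDiffOn ℝ ∞ N U)
    (k : Fin 3) : ContDiffOn ℝ ∞ (fun y => wronskian f N y k) U :=
  (hf.mul (contDiffOn_pd hU hN k)).sub (hN.mul (contDiffOn_pd hU hf k))

theorem pd_wronskian (hU : IsOpen U) (hf : ContDiffOn ℝ ∞ f U) (hN : ContDiffOn ℝ ∞ N U)
    (hx : x ∈ U) (i j : Fin 3) :
    pd i (fun y => wronskian f N y j) x =
      pd i f x * pd j N x - pd i N x * pd j f x + f x * pd i (pd j N) x -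
        N x * pd i (pd j f) x := by
  have hgrad {u : E3 → ℝ} (hu : ContDiffOn ℝ ∞ u U) := hasGrad_of_contDiffOn hU hu hx
  refine ((((hgrad hf).mul (hgrad (contDiffOn_pd hU hN j))).sub
    ((hgrad hN).mul (hgrad (contDiffOn_pd hU hf j)))).pd_eq i).trans ?_
  ring

theorem covForm_wronskian (hU : IsOpen U) (hf : ContDiffOn ℝ ∞ f U) (hN : ContDiffOn ℝ ∞ N U)
    (hx : x ∈ U) (g : Tensor2) (i j : Fin 3) :
    covForm g (wronskian f N) x i j =
      pd i f x * pd j N x - pd i N x * pd j f x + f x * hess g N x i j - N x * hess g f x i j := by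
  rw [covForm, pd_wronskian hU hf hN hx]
  simp only [wronskian, hess, Fin.sum_univ_three]
  ring

theorem IsStaticPotential.isKilling_sharp_wronskian (hg : IsMetricOn g U)
    (hfs : IsStaticPotential g f U) (hNs : IsStaticPotential g N U) (hf : ContDiffOn ℝ ∞ f U)
    (hN : ContDiffOn ℝ ∞ N U) : IsKilling g (sharp g (wronskian f N)) U := fun x hx i j => by
  rw [lieDeriv_sharp hg hx (contDiffOn_wronskian hg.isOpen hf hN),
    covForm_wronskian hg.isOpen hf hN hx, covForm_wronskian hg.isOpen hf hN hx,
    hfs x hx, hfs x hx, hNs x hx, hNs x hx, hg.ricci_symm hx j i]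
  ring

theorem sum_radialTensor_mul (p q : E3 → ℝ) (X : E3 → Fin 3 → ℝ) (x : E3) (j : Fin 3) :
    ∑ l, radialTensor p q x j l * X x l = p x * X x j + q x * x j * radialPart X x := by
  simp only [radialTensor, radialPart, Matrix.of_apply, add_mul, Finset.sum_add_distrib,
    Finset.mul_sum, mul_ite, ite_mul, mul_one, mul_zero, zero_mul, Finset.sum_ite_eq,
    Finset.mem_univ, if_true, mul_assoc]

theorem sum_schwarzschild_mul_rotationField (hx : x ∈ exterior m) (c : Fin 3 → ℝ) (j : Fin 3) :
    ∑ l, schwarzschild m x j l * rotationField c x l = rotationField c x j := by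
  rw [schwarzschild_eq_radialTensor hx]
  refine (sum_radialTensor_mul _ _ (rotationField c) x j).trans ?_
  rw [radialPart_rotationField, one_mul, mul_zero, add_zero]

theorem IsStaticPotential.exists_wronskian_eq_rotationField
    (hfs : IsStaticPotential (schwarzschild m) f U) (hNs : IsStaticPotential (schwarzschild m) N U)
    (hm : m ≠ 0) (hU : IsOpen U) (hUc : IsPreconnected U) (hUe : U ⊆ exterior m)
    (hf : ContDiffOn ℝ ∞ f U) (hN : ContDiffOn ℝ ∞ N U) :
    ∃ c, ∀ x ∈ U, wronskian f N x = rotationField c x := by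
  have hg := (isMetricOn_schwarzschild m).mono hU hUe
  obtain ⟨c, hc⟩ := (hfs.isKilling_sharp_wronskian hg hNs hf hN).exists_eq_rotationField hm hU hUc
    hUe (contDiffOn_sharp hg (contDiffOn_wronskian hU hf hN))
  refine ⟨c, fun x hx => funext fun j => ?_⟩
  rw [← sum_mul_sharp hg hx (wronskian f N) j, hc x hx,
    sum_schwarzschild_mul_rotationField (hUe hx)]

/- The curl of `f dN - N df` is `2 df × dN`, orthogonal to the radial covector `dN`, whereas the
curl of the rotation field about `c` is `2 c`. -/
theorem sum_axis_mul_coord_eq_zero (hU : IsOpen U) (hf : ContDiffOn ℝ ∞ f U)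
    (hN : ContDiffOn ℝ ∞ N U) (hc : ∀ y ∈ U, wronskian f N y = rotationField c y) (hx : x ∈ U)
    {a : ℝ} (ha : ∀ i, pd i N x = a * x i) : ∑ i, c i * x i = 0 := by
  have hcurl (i j : Fin 3) : rotationMatrix c j i - rotationMatrix c i j =
      2 * a * (pd i f x * x j - x i * pd j f x) := by
    rw [← (hasGrad_rotationField c x j).pd_eq i, ← (hasGrad_rotationField c x i).pd_eq j,
      ← pd_congr hU (fun y hy => congrFun (hc y hy) j) hx,
      ← pd_congr hU (fun y hy => congrFun (hc y hy) i) hx, pd_wronskian hU hf hN hx,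
      pd_wronskian hU hf hN hx, pd_comm hU hf hx j i, pd_comm hU hN hx j i, ha, ha]
    ring
  have h01 := hcurl 0 1
  have h12 := hcurl 1 2
  have h20 := hcurl 2 0
  simp only [rotationMatrix, Matrix.of_apply, Matrix.cons_val] at h01 h12 h20
  rw [Fin.sum_univ_three]
  linear_combination (x 0 / 2) * h12 + (x 1 / 2) * h20 + (x 2 / 2) * h01

theorem eq_zero_of_sum_mul_coord_eq_zero (hU : IsOpen U) (hx : x ∈ U)
    (h : ∀ y ∈ U, ∑ i, c i * y i = 0) : c = 0 := by
  funext i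
  have hgrad := (HasGrad.sum Finset.univ fun k _ =>
    (HasGrad.coord (x := x) k).const_mul (c k)).pd_eq i
  rw [pd_congr hU h hx, (HasGrad.const 0).pd_eq] at hgrad
  simpa only [mul_ite, mul_one, mul_zero, Finset.sum_ite_eq, Finset.mem_univ, if_true,
    Pi.zero_apply] using hgrad.symm

theorem exists_eq_const_mul_of_wronskian_eq_zero (hU : IsOpen U) (hUc : IsPreconnected U)
    (hf : ContDiffOn ℝ ∞ f U) (hN : ContDiffOn ℝ ∞ N U) (hN0 : ∀ x ∈ U, N x ≠ 0)
    (h : ∀ x ∈ U, wronskian f N x = 0) : ∃ a, ∀ x ∈ U, f x = a * N x := by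
  have hinv : ContDiffOn ℝ ∞ (fun y => (N y)⁻¹) U := hN.inv hN0
  obtain ⟨a, ha⟩ := exists_eq_const_of_pd_eq_zero hU hUc (hf.mul hinv) fun x hx i => by
    refine ((hasGrad_of_contDiffOn hU hf hx).mul
      ((hasGrad_of_contDiffOn hU hN hx).comp_hasDerivAt (hasDerivAt_inv (hN0 x hx)))).pd_eq i
      |>.trans ?_
    have hi : f x * pd i N x - N x * pd i f x = 0 := congrFun (h x hx) i
    have hNx := hN0 x hx
    field_simp
    linear_combination -hi
  exact ⟨a, fun x hx => by rw [← ha x hx, inv_mul_cancel_right₀ (hN0 x hx)]⟩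

theorem IsStaticPotential.exists_eq_const_mul_lapse (hfs : IsStaticPotential (schwarzschild m) f U)
    (hm : m ≠ 0) (hU : IsOpen U) (hUc : IsPreconnected U) (hUe : U ⊆ exterior m)
    (hf : ContDiffOn ℝ ∞ f U) : ∃ a, ∀ x ∈ U, f x = a * lapse m x := by
  obtain rfl | ⟨x₀, hx₀⟩ := U.eq_empty_or_nonempty
  · exact ⟨0, fun x hx => hx.elim⟩
  have hN := contDiffOn_lapse.mono hUe
  obtain ⟨c, hc⟩ := hfs.exists_wronskian_eq_rotationField
    (fun x hx => isStaticPotential_lapse m x (hUe hx)) hm hU hUc hUe hf hN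
  have hc0 : c = 0 := eq_zero_of_sum_mul_coord_eq_zero hU hx₀ fun x hx =>
    sum_axis_mul_coord_eq_zero hU hf hN hc hx (hasGrad_lapse (hUe hx)).pd_eq
  exact exists_eq_const_mul_of_wronskian_eq_zero hU hUc hf hN
    (fun x hx => (lapse_pos (hUe hx)).ne') fun x hx => by
      rw [hc x hx, hc0, rotationField_zero]

theorem IsStaticPotential.const_mul (hU : IsOpen U) (hf : ContDiffOn ℝ ∞ f U)
    (hfs : IsStaticPotential g f U) (a : ℝ) : IsStaticPotential g (fun x => a * f x) U := by
  intro x hx i j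
  have hpd {y : E3} (hy : y ∈ U) (k : Fin 3) : pd k (fun z => a * f z) y = a * pd k f y :=
    ((hasGrad_of_contDiffOn hU hf hy).const_mul a).pd_eq k
  have hpd2 := ((hasGrad_of_contDiffOn hU (contDiffOn_pd hU hf j) hx).const_mul a).pd_eq i
  have h := hfs x hx i j
  rw [hess, pd_congr hU (fun y hy => hpd hy j) hx, hpd2]
  simp only [hpd hx, mul_assoc, ← h, hess, mul_sub, Finset.mul_sum, mul_left_comm a]

end StaticPotentials

/-! ### The kernel on a region of Schwarzschild space -/

section Kernel

variable {g : Tensor2} {m : ℝ} {H U : Set E3} {x : E3} {f : H → ℝ} {X : H → Fin 3 → ℝ}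
  {F : E3 → ℝ} {Y : E3 → Fin 3 → ℝ}

theorem smoothOn_iff {V : Type} [NormedAddCommGroup V] [NormedSpace ℝ V] {u : H → V} {u' : E3 → V}
    (hu : ∀ x : H, u x = u' x) : SmoothOn H u ↔ ContDiffOn ℝ ∞ u' H := by
  refine contDiffOn_congr fun x hx => ?_
  rw [Subtype.val_injective.extend_apply u 0 ⟨x, hx⟩, hu]

theorem adjointEq_zero_iff (hHm : MeasurableSet H) (hF : ∀ x : H, f x = F x)
    (hY : ∀ x : H, X x = Y x) :
    AdjointEq H g 0 f X 0 0 ↔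
      ∀ h w, IsTest H h → IsTest H w → ∫ x in H, pairing g h w F Y x = 0 := by
  refine forall₂_congr fun h w => forall₂_congr fun _ _ => ?_
  simp only [hF, hY, inner2, Pi.zero_apply, Matrix.zero_apply, mul_zero, zero_mul,
    Finset.sum_const_zero, add_zero, integral_zero]
  rw [← integral_subtype_comap hHm]
  rfl

theorem mem_kerAdjoint_iff (hg : IsMetricOn g U) (hR : ∀ x ∈ U, scalarCurv g x = 0)
    (hHm : MeasurableSet H) (hHU : H ⊆ U) (hF : ∀ x : H, f x = F x) (hY : ∀ x : H, X x = Y x) :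
    (f, X) ∈ kerAdjoint H g 0 ↔
      ContDiffOn ℝ ∞ F H ∧ (∀ i, ContDiffOn ℝ ∞ (fun y => Y y i) H) ∧
        IsStaticPotential g F (interior H) ∧ IsKilling g Y (interior H) := by
  change SmoothOn H f ∧ SmoothOn H X ∧ AdjointEq H g 0 f X 0 0 ↔ _
  rw [smoothOn_iff hF, smoothOn_iff hY, adjointEq_zero_iff hHm hF hY, contDiffOn_pi]
  refine and_congr_right fun hFs => and_congr_right fun hYs => ?_
  exact forall_setIntegral_pairing_eq_zero_iff_static_killing hg hR hHm hHU
    (hFs.mono interior_subset) fun i => (hYs i).mono interior_subset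

theorem exists_eq_of_mem_kerAdjoint_schwarzschild (hm : m ≠ 0) (hHm : MeasurableSet H)
    (hHe : H ⊆ exterior m) (hc : IsPreconnected (interior H)) (hcl : H ⊆ closure (interior H))
    (h : (f, X) ∈ kerAdjoint H (schwarzschild m) 0) :
    ∃ a c, (∀ x : H, f x = a * lapse m x) ∧ ∀ x : H, X x = rotationField c x := by
  set F : E3 → ℝ := Function.extend Subtype.val f 0
  set Y : E3 → Fin 3 → ℝ := Function.extend Subtype.val X 0
  have hF (x : H) : f x = F x := (Subtype.val_injective.extend_apply f 0 x).symm
  have hY (x : H) : X x = Y x := (Subtype.val_injective.extend_apply X 0 x).symm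
  have hUe := interior_subset.trans hHe
  obtain ⟨hFs, hYs, hstatic, hkilling⟩ := (mem_kerAdjoint_iff (isMetricOn_schwarzschild m)
    (fun x hx => scalarCurv_schwarzschild hx) hHm hHe hF hY).1 h
  obtain ⟨a, ha⟩ := hstatic.exists_eq_const_mul_lapse hm isOpen_interior hc hUe
    (hFs.mono interior_subset)
  obtain ⟨c, hc⟩ := hkilling.exists_eq_rotationField hm isOpen_interior hc hUe
    fun i => (hYs i).mono interior_subset
  have hFa : Set.EqOn F (fun y => a * lapse m y) H := Set.EqOn.of_subset_closure ha
    hFs.continuousOn (continuousOn_const.mul (contDiffOn_lapse.mono hHe).continuousOn)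
    interior_subset hcl
  have hYc : Set.EqOn Y (rotationField c) H := Set.EqOn.of_subset_closure hc
    (continuousOn_pi.2 fun i => (hYs i).continuousOn)
    (continuousOn_pi.2 fun i => (contDiffOn_rotationField c H i).continuousOn) interior_subset hcl
  exact ⟨a, c, fun x => (hF x).trans (hFa x.2), fun x => (hY x).trans (hYc x.2)⟩

theorem mem_kerAdjoint_schwarzschild_iff (hm : m ≠ 0) (hHm : MeasurableSet H)
    (hHe : H ⊆ exterior m) (hc : IsPreconnected (interior H)) (hcl : H ⊆ closure (interior H)) :
    (f, X) ∈ kerAdjoint H (schwarzschild m) 0 ↔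
      ∃ a c, (∀ x : H, f x = a * lapse m x) ∧ ∀ x : H, X x = rotationField c x := by
  refine ⟨exists_eq_of_mem_kerAdjoint_schwarzschild hm hHm hHe hc hcl, ?_⟩
  rintro ⟨a, c, hf, hX⟩
  have hUe := interior_subset.trans hHe
  refine (mem_kerAdjoint_iff (F := fun y => a * lapse m y) (isMetricOn_schwarzschild m)
    (fun x hx => scalarCurv_schwarzschild hx) hHm hHe hf hX).2
    ⟨contDiffOn_const.mul (contDiffOn_lapse.mono hHe), contDiffOn_rotationField c H, fun x hx => ?_,
      isKilling_rotationField isOpen_interior hUe c⟩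
  exact (isStaticPotential_lapse m).const_mul (isOpen_exterior m) contDiffOn_lapse a x (hUe hx)

/-- The lapse and the three rotation fields, as pairs (function, vector field) on `H`. -/
def kerBasis (m : ℝ) (H : Set E3) : Fin 4 → (H → ℝ) × (H → Fin 3 → ℝ) :=
  ![((fun x => lapse m x), 0), (0, fun x => rot1 x), (0, fun x => rot2 x), (0, fun x => rot3 x)]

theorem sum_smul_kerBasis (m : ℝ) (H : Set E3) (c : Fin 4 → ℝ) :
    ∑ i, c i • kerBasis m H i =
      ((fun x : H => c 0 * lapse m x), fun x : H => rotationField (Fin.tail c) x) := by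
  simp only [rotationField_eq, kerBasis, Fin.sum_univ_four, Matrix.cons_val, Prod.smul_mk,
    Prod.mk_add_mk, smul_zero, add_zero, zero_add]
  rfl

theorem eq_zero_of_rotationField_eq_zero {c : Fin 3 → ℝ} (hU : IsOpen U) (hx : x ∈ U)
    (h : ∀ y ∈ U, rotationField c y = 0) : c = 0 := by
  have hW (i j : Fin 3) : rotationMatrix c i j = 0 := by
    rw [← (hasGrad_rotationField c x i).pd_eq j,
      pd_congr hU (fun y hy => congrFun (h y hy) i) hx]
    exact (HasGrad.const 0).pd_eq j
  ext i
  fin_cases i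
  exacts [hW 2 1, hW 0 2, hW 1 0]

theorem linearIndependent_kerBasis (hHe : H ⊆ exterior m) (hne : (interior H).Nonempty) :
    LinearIndependent ℝ (kerBasis m H) := by
  rw [Fintype.linearIndependent_iff]
  intro c hc
  rw [sum_smul_kerBasis, Prod.mk_eq_zero] at hc
  obtain ⟨x₀, hx₀⟩ := hne
  have hlapse : c 0 = 0 := (mul_eq_zero.1 (congrFun hc.1 ⟨x₀, interior_subset hx₀⟩)).resolve_right
    (lapse_pos (hHe (interior_subset hx₀))).ne'
  have hrot : Fin.tail c = 0 := eq_zero_of_rotationField_eq_zero isOpen_interior hx₀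
    fun y hy => congrFun hc.2 ⟨y, interior_subset hy⟩
  exact Fin.cases hlapse fun i => congrFun hrot i

theorem coe_span_kerBasis (hm : m ≠ 0) (hHm : MeasurableSet H) (hHe : H ⊆ exterior m)
    (hc : IsPreconnected (interior H)) (hcl : H ⊆ closure (interior H)) :
    (Submodule.span ℝ (Set.range (kerBasis m H)) : Set ((H → ℝ) × (H → Fin 3 → ℝ))) =
      kerAdjoint H (schwarzschild m) 0 := by
  ext ⟨f, X⟩
  rw [mem_kerAdjoint_schwarzschild_iff hm hHm hHe hc hcl, SetLike.mem_coe,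
    Submodule.mem_span_range_iff_exists_fun]
  simp only [sum_smul_kerBasis, Prod.mk.injEq, funext_iff (α := H)]
  constructor
  · rintro ⟨c, hf, hX⟩
    exact ⟨c 0, Fin.tail c, fun x => (hf x).symm, fun x => (hX x).symm⟩
  · rintro ⟨a, c, hf, hX⟩
    exact ⟨Fin.cons a c, fun x => (hf x).symm, fun x => (hX x).symm⟩

end Kernel

/-! ### Spherical shells -/

section Shell

variable {m : ℝ} {I : Set ℝ}

theorem shell_subset_exterior (hpos : ∀ r ∈ I, 0 < r) (hout : ∀ r ∈ I, 2 * m < r) :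
    shell I ⊆ exterior m := fun _ hx => ⟨hpos _ hx, hout _ hx⟩

theorem measurableSet_shell (hI : MeasurableSet I) : MeasurableSet (shell I) :=
  measurable_norm hI

theorem shell_interior_subset (I : Set ℝ) : shell (interior I) ⊆ interior (shell I) :=
  interior_maximal (fun _ hx => interior_subset (s := I) hx)
    (isOpen_interior.preimage continuous_norm)

theorem shell_eq_image (hpos : ∀ r ∈ I, 0 < r) :
    shell I = (fun q : ℝ × E3 => q.1 • q.2) '' (I ×ˢ Metric.sphere (0 : E3) 1) := by
  ext x
  constructor
  · intro hx
    have h0 : ‖x‖ ≠ 0 := (hpos _ hx).ne'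
    refine ⟨(‖x‖, ‖x‖⁻¹ • x), ⟨hx, ?_⟩, smul_inv_smul₀ h0 x⟩
    rw [mem_sphere_zero_iff_norm, norm_smul, norm_inv, norm_norm, inv_mul_cancel₀ h0]
  · rintro ⟨⟨r, v⟩, ⟨hr, hv⟩, rfl⟩
    change ‖r • v‖ ∈ I
    rwa [norm_smul, mem_sphere_zero_iff_norm.1 hv, mul_one, Real.norm_of_nonneg (hpos r hr).le]

theorem isConnected_shell (hI : IsConnected I) (hpos : ∀ r ∈ I, 0 < r) :
    IsConnected (shell I) := by
  have hrank : 1 < Module.rank ℝ E3 := by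
    rw [rank_eq_card_basis (EuclideanSpace.basisFun (Fin 3) ℝ).toBasis]
    norm_num
  rw [shell_eq_image hpos]
  exact (hI.prod (isConnected_sphere hrank 0 zero_le_one)).image _
    (continuous_fst.smul continuous_snd).continuousOn

theorem shell_subset_closure_shell {J : Set ℝ} (hIJ : I ⊆ closure J) (hI : ∀ r ∈ I, 0 < r)
    (hJ : ∀ r ∈ J, 0 < r) : shell I ⊆ closure (shell J) := by
  intro x hx
  have h0 : ‖x‖ ≠ 0 := (hI _ hx).ne'
  have hmap : Set.MapsTo (fun r : ℝ => r • (‖x‖⁻¹ • x)) J (shell J) := by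
    intro r hr
    change ‖r • (‖x‖⁻¹ • x)‖ ∈ J
    rwa [norm_smul, norm_smul, norm_inv, norm_norm, inv_mul_cancel₀ h0, mul_one,
      Real.norm_of_nonneg (hJ r hr).le]
  have hclosure := map_mem_closure
    (by fun_prop : Continuous fun r : ℝ => r • (‖x‖⁻¹ • x)) (hIJ hx) hmap
  rwa [smul_inv_smul₀ h0] at hclosure

theorem shell_subset_closure_shell_interior (hI : I.OrdConnected) (hne : (interior I).Nonempty)
    (hpos : ∀ r ∈ I, 0 < r) : shell I ⊆ closure (shell (interior I)) := by
  refine shell_subset_closure_shell ?_ hpos fun r hr => hpos r (interior_subset hr)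
  rw [(hI.convex (𝕜 := ℝ)).closure_interior_eq_closure_of_nonempty_interior hne]
  exact subset_closure

theorem isConnected_interior_shell (hI : I.OrdConnected) (hne : (interior I).Nonempty)
    (hpos : ∀ r ∈ I, 0 < r) : IsConnected (interior (shell I)) :=
  (isConnected_shell ⟨hne, hI.interior.isPreconnected⟩
    fun r hr => hpos r (interior_subset hr)).subset_closure (shell_interior_subset I)
    (interior_subset.trans (shell_subset_closure_shell_interior hI hne hpos))

theorem shell_subset_closure_interior (hI : I.OrdConnected) (hne : (interior I).Nonempty)
    (hpos : ∀ r ∈ I, 0 < r) : shell I ⊆ closure (interior (shell I)) :=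
  (shell_subset_closure_shell_interior hI hne hpos).trans (closure_mono (shell_interior_subset I))

end Shell

end Constraint

end

theorem mainTheorem7_general (m : ℝ) (hm : m ≠ 0) (H : Set Constraint.E3) (hHm : MeasurableSet H)
    (hHe : H ⊆ Constraint.exterior m) (hc : IsConnected (interior H))
    (hcl : H ⊆ closure (interior H)) :
    ∃ K : Submodule ℝ ((H → ℝ) × (H → Fin 3 → ℝ)),
      (K : Set ((H → ℝ) × (H → Fin 3 → ℝ))) =
          Constraint.kerAdjoint H (Constraint.schwarzschild m) 0 ∧
        Module.finrank ℝ K = 4 ∧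
        K = Submodule.span ℝ
          {((fun x : H => Constraint.lapse m x), 0), (0, fun x : H => Constraint.rot1 x),
            (0, fun x : H => Constraint.rot2 x), (0, fun x : H => Constraint.rot3 x)} := by
  refine ⟨Submodule.span ℝ (Set.range (Constraint.kerBasis m H)),
    Constraint.coe_span_kerBasis hm hHm hHe hc.isPreconnected hcl, ?_, ?_⟩
  · rw [finrank_span_eq_card (Constraint.linearIndependent_kerBasis hHe hc.nonempty),
      Fintype.card_fin]
  · simp only [Constraint.kerBasis, Matrix.range_cons, Matrix.range_empty, Set.union_empty,
      Set.singleton_union]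

theorem mainTheorem7 (m₀ : ℝ) (hm : m₀ ≠ 0) (I : Set ℝ) (hI : I.OrdConnected)
    (hne : (interior I).Nonempty) (hpos : ∀ r ∈ I, 0 < r) (hout : ∀ r ∈ I, 2 * m₀ < r) :
    ∃ K : Submodule ℝ
        ((Constraint.shell I → ℝ) × (Constraint.shell I → Fin 3 → ℝ)),
      (K : Set ((Constraint.shell I → ℝ) × (Constraint.shell I → Fin 3 → ℝ))) =
          Constraint.kerAdjoint (Constraint.shell I) (Constraint.schwarzschild m₀) 0 ∧
        Module.finrank ℝ K = 4 ∧
        K = Submodule.span ℝ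
          {((fun x : Constraint.shell I => Constraint.lapse m₀ x), 0),
            (0, fun x : Constraint.shell I => Constraint.rot1 x),
            (0, fun x : Constraint.shell I => Constraint.rot2 x),
            (0, fun x : Constraint.shell I => Constraint.rot3 x)} := by
  exact mainTheorem7_general m₀ hm (Constraint.shell I)
    (Constraint.measurableSet_shell hI.measurableSet)
    (Constraint.shell_subset_exterior hpos hout)
    (Constraint.isConnected_interior_shell hI hne hpos)
    (Constraint.shell_subset_closure_interior hI hne hpos)
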